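/- Let $s\ge 1$ and let $\alpha\ge 2$ be an even integer. Let $\gamma=(\gamma_u)_{u\subseteq\{1,\dots,s\}}$ be weights with $\gamma_u\ge 0$. For a positive semidefinite kernel $K$ on $[0,1]^s$ let $\mathcal H(K)$ be the reproducing kernel Hilbert space of real functions with kernel $K$. For a finite multiset $P$ of points in $[0,1]^s$ put $$e^{\rm wor}(P;\mathcal H(K))=\sup_{f\in\mathcal H(K),\,\|f\|\le 1}\Bigl|\frac1{|P|}\sum_{x\in P}f(x)-\int_{[0,1]^s}f(x)\,dx\Bigr|,$$ where points are counted with multiplicity. With $B_\tau$ the Bernoulli polynomial of degree $\tau$, put $$k_\alpha(x,y)=\sum_{\substack{1\le\tau\le\alpha\\ \tau\ \text{odd or}\ \tau=\alpha}}\frac{B_\tau(x)B_\tau(y)}{(\tau!)^2}+(-1)^{\alpha+1}\frac{B_{2\alpha}(|x-y|)}{(2\alpha)!},\qquad K^{\rm sob\text{-}odd+\alpha}_{\alpha,\gamma,s}(x,y)=1+\sum_{\emptyset\ne u\subseteq\{1,\dots,s\}}\gamma_u\prod_{j\in u}k_\alpha(x_j,y_j).$$ For $a>1/2$ and weights $w=(w_u)$,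 let $K^{\rm kor}_{a,w,s}(x,y)=\sum_{h\in\mathbb Z^s}r(h)e^{2\pi i h\cdot(x-y)}$ be the Korobov kernel of smoothness $a$, where $r(0)=1$ and, for $h\ne 0$ with $u=\{j:h_j\ne0\}$, $r(h)=w_u\prod_{j\in u}|h_j|^{-2a}$. For $z\in\{1,\dots,N-1\}^s$ let $P_{N,z}$ be the lattice point set (with multiplicity) of the points $\{nz/N\}$, $0\le n<N$, where $\{\cdot\}$ is the componentwise fractional part. Let $P^{\rm sym}_{N,z}$ be the multiset of the $2^sN$ points obtained from $P_{N,z}$ by applying, for each $u\subseteq\{1,\dots,s\}$, the reflection $x_j\mapsto 1-x_j$ in all the coordinates $j\in u$. Let $w_u=(\gamma''_u)^{1/2}$ with $\gamma''_u=\gamma_u\bigl(3/(2^{2\alpha+1}\pi^{2\alpha})\bigr)^{|u|}$. The component-by-component (CBC) algorithm chooses successively, for $d=1,\dots,s$, a component $z_d\in\{1,\dots,N-1\}$ that minimizes the squared worst-case error $e^{\rm wor}(P_{N,(z_1,\dots,z_d)};\mathcal H(K^{\rm kor}_{\alpha/2,(w_u)_{u\subseteq\{1,\dots,d\}},d}))^2$,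 with $z_1,\dots,z_{d-1}$ kept fixed; ties are broken arbitrarily. (The fast CBC algorithm is an implementation of this selection rule.) Then, for every prime $N$, the CBC algorithm has an output $z\in\{1,\dots,N-1\}^s$, and every output $z$ satisfies $$e^{\rm wor}(P^{\rm sym}_{N,z};\mathcal H(K^{\rm sob\text{-}odd+\alpha}_{\alpha,\gamma,s}))\le\bigl(e^{\rm wor}(P_{N,z};\mathcal H(K^{\rm kor}_{\alpha/2,w,s}))\bigr)^2\le\frac1{(N-1)^{1/\lambda}}\Biggl(\sum_{\emptyset\ne u\subseteq\{1,\dots,s\}}\gamma_u^{\lambda/2}\Bigl(\frac{3^{\lambda/2}\zeta(\alpha\lambda)}{2^{(2\alpha+1)\lambda/2-1}\pi^{\alpha\lambda}}\Bigr)^{|u|}\Biggr)^{1/\lambda}$$ for all $\lambda\in(1/\alpha,1]$, where $\zeta$ is the Riemann zeta function. Consequently, for every $\varepsilon>0$ there is a constant $C$, depending only on $s,\alpha,\gamma,\varepsilon$, such that $e^{\rm wor}(P^{\rm sym}_{N,z};\mathcal H(K^{\rm sob\text{-}odd+\alpha}_{\alpha,\gamma,s}))\le C N^{-\alpha+\varepsilon}$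 for every prime $N$ and every such output $z$. -/

import Mathlib

open MeasureTheory
open scoped NNReal ENNReal unitInterval

noncomputable section

namespace LatticeQMC

/-! ### Reproducing kernel Hilbert spaces of real functions -/

/-- A real kernel, with its values regarded as operators on `ℝ`. -/
def opKernel {X : Type*} (K : Matrix X X ℝ) : Matrix X X (ℝ →L[ℝ] ℝ) :=
  Matrix.of fun x y => K x y • ContinuousLinearMap.id ℝ ℝ

instance opKernel_posSemidef {X : Type*} (K : Matrix X X ℝ) [hK : Fact K.PosSemidef] :
    Fact (opKernel K).PosSemidef := by
  refine ⟨((RKHS.posSemidef_tfae (K := opKernel K)).out 0 2).mpr (And.intro ?_ fun v => ?_)⟩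
  · ext x y
    have h := hK.out.1.apply x y
    simp only [star_trivial] at h
    simp [opKernel, Matrix.conjTranspose_apply, ContinuousLinearMap.star_eq_adjoint, h, ContinuousLinearMap.adjoint_id]
  · have h := hK.out.2 v
    rw [Finsupp.sum_comm] at h
    refine h.trans_eq ?_
    simp [opKernel, mul_comm, mul_left_comm]

/-- The reproducing kernel Hilbert space `H(K)` of real functions on `X` with the positive
semidefinite kernel `K`. -/
abbrev HSpace {X : Type*} (K : Matrix X X ℝ) [Fact K.PosSemidef] : Type _ :=
  RKHS.OfKernel (opKernel K)

/-! ### Quasi-Monte Carlo rules and worst-case errors -/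

/-- The QMC rule: the average of `f` over the points of `P`, counted with multiplicity. -/
def qmcRule {X : Type*} (P : Multiset X) (f : X → ℝ) : ℝ :=
  (P.map f).sum / (Multiset.card P : ℝ)

/-- The worst-case error of the QMC rule on `P` over the unit ball of the function space `H`,
a supremum in `[0, ∞]`. -/
def worstCaseError {X : Type*} [MeasureSpace X] (H : Type*) [NormedAddCommGroup H]
    [InnerProductSpace ℝ H] [RKHS ℝ H X ℝ] (P : Multiset X) : ℝ≥0∞ :=
  ⨆ f : {f : H // ‖f‖ ≤ 1}, ENNReal.ofReal |qmcRule P (f : H) - ∫ x : X, (f : H) x|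

/-- The unit cube `[0,1]^s`, with the Lebesgue measure. -/
abbrev Cube (s : ℕ) : Type := Fin s → I

/-- The rank-1 lattice point set with `N` points and generating vector `z`. -/
def latticePoints {s : ℕ} (N : ℕ) (z : Fin s → ℕ) : Multiset (Cube s) :=
  (Multiset.range N).map fun n j =>
    ⟨Int.fract ((n : ℝ) * (z j : ℝ) / (N : ℝ)), Int.fract_nonneg _, (Int.fract_lt_one _).le⟩

/-- Reflection `x_j ↦ 1 - x_j` of the coordinates `j ∈ u`. -/
def reflect {s : ℕ} (u : Finset (Fin s)) (x : Cube s) : Cube s :=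
  fun j => if j ∈ u then σ (x j) else x j

/-- The symmetrization of a point set, a multiset with `2 ^ s` times as many points. -/
def symmetrize {s : ℕ} (P : Multiset (Cube s)) : Multiset (Cube s) :=
  (Finset.univ : Finset (Finset (Fin s))).val.bind fun u => P.map (reflect u)

/-! ### Positive semidefiniteness of the kernels -/

theorem psd_of_hasSum {X ι : Type*} {A : ι → Matrix X X ℝ} {K : Matrix X X ℝ}
    (hA : ∀ i, (A i).PosSemidef) (h : ∀ x y, HasSum (fun i => A i x y) (K x y)) :
    K.PosSemidef := by
  refine ⟨?_, fun c => ?_⟩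
  · ext x y
    simp only [Matrix.conjTranspose_apply, star_trivial]
    refine (h y x).unique ?_
    convert h x y using 2 with i
    simpa using (hA i).1.apply x y
  · have key : HasSum (fun i => c.sum fun x a => c.sum fun y b => star a * A i x y * b)
        (c.sum fun x a => c.sum fun y b => star a * K x y * b) := by
      simp only [Finsupp.sum]
      exact hasSum_sum fun x _ => hasSum_sum fun y _ => ((h x y).mul_left _).mul_right _
    exact key.nonneg fun i => (hA i).2 c

theorem psd_rankOne {X : Type*} (f : X → ℝ) :
    (Matrix.of fun x y => f x * f y : Matrix X X ℝ).PosSemidef := by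
  refine ⟨?_, fun c => ?_⟩
  · ext x y
    simp [mul_comm]
  · have : (c.sum fun x a => c.sum fun y b => star a * (f x * f y) * b)
        = (c.sum fun x a => a * f x) ^ 2 := by
      rw [sq, Finsupp.sum_mul]
      refine Finsupp.sum_congr fun x _ => ?_
      rw [Finsupp.mul_sum]
      refine Finsupp.sum_congr fun y _ => ?_
      simp only [star_trivial]
      ring
    simp only [Matrix.of_apply]
    rw [this]
    positivity

theorem psd_cos_sub {X : Type*} (t : X → ℝ) :
    (Matrix.of fun x y => Real.cos (t x - t y) : Matrix X X ℝ).PosSemidef := by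
  convert (psd_rankOne fun x => Real.cos (t x)).add (psd_rankOne fun x => Real.sin (t x)) using 1
  ext x y
  simp [Real.cos_sub]

theorem psd_smul {X : Type*} {A : Matrix X X ℝ} (hA : A.PosSemidef) {c : ℝ} (hc : 0 ≤ c) :
    (Matrix.of fun x y => c * A x y : Matrix X X ℝ).PosSemidef := by
  have h := hA.smul hc
  have e : (Matrix.of fun x y => c * A x y : Matrix X X ℝ) = c • A := by
    ext x y
    simp
  rw [e]
  exact h

theorem psd_sum {X ι : Type*} (t : Finset ι) {A : ι → Matrix X X ℝ}
    (hA : ∀ i ∈ t, (A i).PosSemidef) :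
    (Matrix.of fun x y => ∑ i ∈ t, A i x y : Matrix X X ℝ).PosSemidef := by
  refine psd_of_hasSum (A := fun i : t => A i) (fun i => hA i i.2) fun x y => ?_
  exact t.hasSum fun i => A i x y

theorem psd_one {X : Type*} : (Matrix.of fun _ _ => 1 : Matrix X X ℝ).PosSemidef := by
  convert psd_rankOne fun _ : X => (1 : ℝ) using 1
  simp

theorem psd_prod {X ι : Type*} (t : Finset ι) {A : ι → Matrix X X ℝ}
    (hA : ∀ i ∈ t, (A i).PosSemidef) :
    (Matrix.of fun x y => ∏ i ∈ t, A i x y : Matrix X X ℝ).PosSemidef := by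
  classical
  induction t using Finset.induction_on with
  | empty => simpa using psd_one
  | insert a t ha ih =>
    have h1 := (hA a (Finset.mem_insert_self a t)).hadamard
      (ih fun i hi => hA i (Finset.mem_insert_of_mem hi))
    have e : (Matrix.of fun x y => ∏ i ∈ insert a t, A i x y : Matrix X X ℝ) =
        (A a).hadamard (Matrix.of fun x y => ∏ i ∈ t, A i x y) := by
      ext x y
      simp [Finset.prod_insert ha]
    rw [e]
    exact h1

theorem psd_comp {X Y : Type*} {A : Matrix X X ℝ} (hA : A.PosSemidef) (f : Y → X) :
    (Matrix.of fun x y => A (f x) (f y) : Matrix Y Y ℝ).PosSemidef :=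
  hA.submatrix f

/-! ### Weighted Korobov spaces -/

/-- The Fourier weights `r(0) = 1` and `r(h) = γ_u ∏_{j ∈ u} |h_j|^(-2a)`, where `u` is the set
of the indices with `h_j ≠ 0`. -/
def korobovWeight {s : ℕ} (a : ℝ) (γ : Finset (Fin s) → ℝ≥0) (h : Fin s → ℤ) : ℝ :=
  if h = 0 then 1
  else (γ {j | h j ≠ 0} : ℝ) * ∏ j with h j ≠ 0, |(h j : ℝ)| ^ (-2 * a)

/-- The reproducing kernel of the weighted Korobov space of smoothness `a`. The sum of the series
is real; its real part is taken only to obtain a value in `ℝ`. -/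
def korobovKernel {s : ℕ} (a : ℝ) (γ : Finset (Fin s) → ℝ≥0) :
    Matrix (Cube s) (Cube s) ℝ :=
  Matrix.of fun x y => (∑' h : Fin s → ℤ, (korobovWeight a γ h : ℂ) *
    Complex.exp (2 * Real.pi * Complex.I * ∑ j, (h j : ℂ) * ((x j : ℝ) - (y j : ℝ) : ℂ))).re

theorem korobovWeight_nonneg {s : ℕ} (a : ℝ) (γ : Finset (Fin s) → ℝ≥0) (h : Fin s → ℤ) :
    0 ≤ korobovWeight a γ h := by
  unfold korobovWeight
  split_ifs
  · exact zero_le_one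
  · positivity

theorem korobov_arg {s : ℕ} (h : Fin s → ℤ) (x y : Cube s) :
    2 * Real.pi * Complex.I * ∑ j, (h j : ℂ) * ((x j : ℝ) - (y j : ℝ) : ℂ) =
      ((2 * Real.pi * ∑ j, (h j : ℝ) * (x j : ℝ) - 2 * Real.pi * ∑ j, (h j : ℝ) * (y j : ℝ) : ℝ)
        : ℂ) * Complex.I := by
  push_cast
  simp only [mul_sub, Finset.sum_sub_distrib]
  ring

instance korobovKernel_posSemidef {s : ℕ} (a : ℝ) (γ : Finset (Fin s) → ℝ≥0) :
    Fact (korobovKernel a γ).PosSemidef := by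
  constructor
  by_cases hs : Summable (korobovWeight a γ)
  · refine psd_of_hasSum (fun h : Fin s → ℤ => psd_smul
      (psd_cos_sub fun x : Cube s => 2 * Real.pi * ∑ j, (h j : ℝ) * (x j : ℝ))
      (korobovWeight_nonneg a γ h)) fun x y => ?_
    simp only [korobovKernel, Matrix.of_apply, korobov_arg]
    have hsum : Summable fun h : Fin s → ℤ => (korobovWeight a γ h : ℂ) *
        Complex.exp (((2 * Real.pi * ∑ j, (h j : ℝ) * (x j : ℝ)
          - 2 * Real.pi * ∑ j, (h j : ℝ) * (y j : ℝ) : ℝ) : ℂ) * Complex.I) := by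
      refine Summable.of_norm ?_
      simp only [norm_mul, Complex.norm_exp_ofReal_mul_I, mul_one, Complex.norm_real]
      exact hs.norm
    convert Complex.hasSum_re hsum.hasSum using 2 with h
    rw [Complex.re_ofReal_mul, Complex.exp_ofReal_mul_I_re]
  · have : korobovKernel a γ = Matrix.of fun _ _ => 0 * (1 : ℝ) := by
      ext x y
      simp only [korobovKernel, Matrix.of_apply, korobov_arg, zero_mul]
      rw [tsum_eq_zero_of_not_summable, Complex.zero_re]
      intro hc
      apply hs
      have := hc.norm
      simpa only [norm_mul, Complex.norm_exp_ofReal_mul_I, mul_one, Complex.norm_real,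
        Real.norm_of_nonneg (korobovWeight_nonneg a γ _)] using this
    rw [this]
    exact psd_smul psd_one le_rfl

/-- The weighted Korobov space of smoothness `a`. -/
abbrev KorobovSpace {s : ℕ} (a : ℝ) (γ : Finset (Fin s) → ℝ≥0) : Type :=
  HSpace (korobovKernel a γ)

/-! ### The intermediate Sobolev spaces -/

/-- The kernel `K - 1` in one variable of unit weight:
`∑_τ B_τ(x) B_τ(y) / (τ!)² + (-1)^(α+1) B_{2α}(|x-y|) / (2α)!`, where `τ` runs through the odd
integers in `[1, α]` and `τ = α`. -/
def sobOddKernelOne (α : ℕ) : Matrix I I ℝ :=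
  Matrix.of fun x y =>
    (∑ τ ∈ Finset.Icc 1 α with (Odd τ ∨ τ = α),
      bernoulliFun τ x * bernoulliFun τ y / (τ.factorial : ℝ) ^ 2) +
    (-1) ^ (α + 1) * bernoulliFun (2 * α) |(x : ℝ) - (y : ℝ)| / ((2 * α).factorial : ℝ)

/-- The reproducing kernel of the weighted space of dimension `s`. -/
def sobOddKernel {s : ℕ} (α : ℕ) (γ : Finset (Fin s) → ℝ≥0) :
    Matrix (Cube s) (Cube s) ℝ :=
  Matrix.of fun x y => 1 + ∑ u ∈ (Finset.univ : Finset (Finset (Fin s))).erase ∅,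
    (γ u : ℝ) * ∏ j ∈ u, sobOddKernelOne α (x j) (y j)

theorem sobOddKernelOne_posSemidef (α : ℕ) (hα : α ≠ 0) : (sobOddKernelOne α).PosSemidef := by
  refine Matrix.PosSemidef.add
    (A := Matrix.of fun x y : I => ∑ τ ∈ Finset.Icc 1 α with (Odd τ ∨ τ = α),
      bernoulliFun τ x * bernoulliFun τ y / (τ.factorial : ℝ) ^ 2)
    (B := Matrix.of fun x y : I =>
      (-1) ^ (α + 1) * bernoulliFun (2 * α) |(x : ℝ) - (y : ℝ)| / ((2 * α).factorial : ℝ)) ?_ ?_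
  · refine psd_sum _ (A := fun τ => Matrix.of fun x y : I =>
      bernoulliFun τ x * bernoulliFun τ y / (τ.factorial : ℝ) ^ 2) fun τ _ => ?_
    convert psd_smul (psd_rankOne fun x : I => bernoulliFun τ x)
      (c := 1 / (τ.factorial : ℝ) ^ 2) (by positivity) using 1
    ext x y
    simp only [Matrix.of_apply]
    ring
  · refine psd_of_hasSum (A := fun n : ℕ => Matrix.of fun x y : I =>
      (2 / (2 * Real.pi) ^ (2 * α) * (1 / (n : ℝ) ^ (2 * α))) *
        Real.cos (2 * Real.pi * n * (x : ℝ) - 2 * Real.pi * n * (y : ℝ)))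
      (fun n => psd_smul (psd_cos_sub fun x : I => 2 * Real.pi * n * (x : ℝ)) (by positivity))
      fun x y => ?_
    have hxy : |(x : ℝ) - (y : ℝ)| ∈ Set.Icc (0 : ℝ) 1 := by
      refine ⟨abs_nonneg _, abs_le.mpr ⟨?_, ?_⟩⟩ <;> linarith [x.2.1, x.2.2, y.2.1, y.2.2]
    have h := (hasSum_one_div_nat_pow_mul_cos hα hxy).mul_left (2 / (2 * Real.pi) ^ (2 * α))
    have hpi : (2 * Real.pi) ^ (2 * α) ≠ 0 := by positivity
    have hf : ((2 * α).factorial : ℝ) ≠ 0 := by positivity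
    have e : (-1) ^ (α + 1) * bernoulliFun (2 * α) |(x : ℝ) - (y : ℝ)| /
        ((2 * α).factorial : ℝ) = 2 / (2 * Real.pi) ^ (2 * α) *
          ((-1 : ℝ) ^ (α + 1) * (2 * Real.pi) ^ (2 * α) / 2 / ((2 * α).factorial : ℝ) *
            bernoulliFun (2 * α) |(x : ℝ) - (y : ℝ)|) := by
      field_simp
    simp only [Matrix.of_apply]
    rw [e]
    refine h.congr_fun ?_
    intro n
    rw [← mul_sub, ← Real.cos_abs (2 * Real.pi * n * ((x : ℝ) - y)), abs_mul,
      abs_of_nonneg (by positivity : 0 ≤ 2 * Real.pi * (n : ℝ))]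
    ring

instance sobOddKernel_posSemidef {s : ℕ} (α : ℕ) [NeZero α] (γ : Finset (Fin s) → ℝ≥0) :
    Fact (sobOddKernel α γ).PosSemidef := by
  constructor
  refine Matrix.PosSemidef.add (A := Matrix.of fun _ _ : Cube s => (1 : ℝ))
    (B := Matrix.of fun x y : Cube s => ∑ u ∈ (Finset.univ : Finset (Finset (Fin s))).erase ∅,
      (γ u : ℝ) * ∏ j ∈ u, sobOddKernelOne α (x j) (y j)) psd_one ?_
  refine psd_sum _ (A := fun u => Matrix.of fun x y : Cube s =>
    (γ u : ℝ) * ∏ j ∈ u, sobOddKernelOne α (x j) (y j)) fun u _ => ?_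
  exact psd_smul (psd_prod u (A := fun j => Matrix.of fun x y : Cube s =>
    sobOddKernelOne α (x j) (y j)) fun j _ =>
      psd_comp (sobOddKernelOne_posSemidef α (NeZero.ne α)) fun x : Cube s => x j) (γ u).2

/-- The weighted space `H(K^{sob-odd+α})`. -/
abbrev SobOddSpace {s : ℕ} (α : ℕ) [NeZero α] (γ : Finset (Fin s) → ℝ≥0) : Type :=
  HSpace (sobOddKernel α γ)

/-! ### The component-by-component algorithm -/

/-- The weights of the projection to the first `d` coordinates. -/
def restrictWeights {s d : ℕ} (hd : d ≤ s) (γ : Finset (Fin s) → ℝ≥0) :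
    Finset (Fin d) → ℝ≥0 :=
  fun u => γ (u.map (Fin.castLEEmb hd))

/-- `z` is a possible output of the component-by-component algorithm for the quality criterion
`E d` in the dimensions `d = 1, …, s`: one after the other, the components are chosen in
`{1, …, N - 1}` such that, with the components before kept fixed, the criterion of the
current dimension is minimal. Ties may be broken in any way. -/
def IsCBCOutput {s : ℕ} (N : ℕ) (E : ∀ d : ℕ, d ≤ s → (Fin d → ℕ) → ℝ≥0∞)
    (z : Fin s → ℕ) : Prop :=
  ∀ (d : ℕ) (hd : d < s), z ⟨d, hd⟩ ∈ Finset.Icc 1 (N - 1) ∧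
    ∀ c ∈ Finset.Icc 1 (N - 1),
      E (d + 1) hd (Fin.snoc (fun j : Fin d => z (Fin.castLE hd.le j)) (z ⟨d, hd⟩)) ≤
        E (d + 1) hd (Fin.snoc (fun j : Fin d => z (Fin.castLE hd.le j)) c)

/-- The squared worst-case error of lattice rules in the Korobov spaces of smoothness `a`, whose
weights in dimension `d ≤ s` are those of the projection to the first `d` coordinates. -/
def korobovCriterion {s : ℕ} (a : ℝ) (γ : Finset (Fin s) → ℝ≥0) (N : ℕ) (d : ℕ) (hd : d ≤ s)
    (z : Fin d → ℕ) : ℝ≥0∞ :=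
  worstCaseError (KorobovSpace a (restrictWeights hd γ)) (latticePoints N z) ^ 2

/-- The weights `(γ''_u)^{1/2}` with `γ''_u = γ_u (3 / (2^{2α+1} π^{2α}))^{|u|}`. -/
def modifiedWeights {s : ℕ} (α : ℕ) (γ : Finset (Fin s) → ℝ≥0) : Finset (Fin s) → ℝ≥0 :=
  fun u => NNReal.sqrt (γ u * (3 / (2 ^ (2 * α + 1) * NNReal.pi ^ (2 * α))) ^ u.card)

end LatticeQMC

end

noncomputable section

namespace LatticeQMC

/-! ### The worst-case error in terms of the kernel -/

section Rkhs

open InnerProductSpace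

/-! Write `a` for `α` and `b_a(t) = ∑_{h ≠ 0} |h|^{-a} e^{2πiht}`, a multiple of the Bernoulli
polynomial `B_a` on `[0,1]`. Both kernels have the form `1 + ∑_u γ_u ∏_{j ∈ u} k(x_j, y_j)` with a
continuous `k` whose sections have mean zero. For such a kernel the squared worst-case error is its
average over all pairs of points, minus `1` (`worstCaseError_sq`).

Symmetrization. On lattice points a character averages to `1` or `0`, so the squared Korobov error
is `∑_u w_u S_u`, where `S_u ≥ 0` is the average of `∏_{j ∈ u} b_a(x_j)` over the points. Reflecting
the points replaces `k` by its average over reflections: the odd Bernoulli terms cancel, and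
`(2π)^{-2a} (b_a(x) b_a(y) + ∑_{h ≠ 0} |h|^{-2a} cos(2πhx) cos(2πhy))` remains. As a double cosine
series its coefficients are nonnegative and at most `3/2` times those of `(2π)^{-2a} b_a(x) b_a(y)`,
since the second sum can be spread evenly over the diagonal and the antidiagonal. Products of
cosines have nonnegative averages over a lattice, so this domination of coefficients passes to pair
averages (`pairAverage_prod_mono`). The squared error of the symmetrized rule is therefore at most
`∑_u (w_u S_u)² ≤ (∑_u w_u S_u)²`, the fourth power of the Korobov error
(`worstCaseError_sobOdd_le`).

CBC bound. A new component `c` adds to the squared error the terms of the dual lattice with nonzero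
last frequency. The minimal increment, raised to the power `λ`, is at most the mean of the `λ`-th
powers over all `c`. Subadditivity of `t ↦ t^λ` and a count of the `c` solving a linear congruence
modulo `N` bound that mean (`sum_increment_rpow_le`). Induction on the dimension then gives `(N - 1)
e^{2λ} ≤ ∑_{h ≠ 0} r(h)^λ` (`IsCBCOutput.criterion_rpow_le`), and the right side is evaluated with
`ζ`. -/

theorem qmcRule_const {X : Type*} {P : Multiset X} (hP : P ≠ 0) (c : ℝ) :
    qmcRule P (fun _ => c) = c := by
  have : (Multiset.card P : ℝ) ≠ 0 := by simpa using hP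
  simp only [qmcRule, Multiset.map_const', Multiset.sum_replicate, nsmul_eq_mul]
  field_simp

theorem qmcRule_sub {X : Type*} (P : Multiset X) (f g : X → ℝ) :
    qmcRule P (fun x => f x - g x) = qmcRule P f - qmcRule P g := by
  simp [qmcRule, Multiset.sum_map_sub, sub_div]

variable {X : Type*} (K : Matrix X X ℝ) [Fact K.PosSemidef]

/-- The function `K(·, x)` as an element of `H(K)`. -/
def kerVec (x : X) : HSpace K := RKHS.kerFun (HSpace K) x (1 : ℝ)

theorem inner_kerVec_left (x : X) (f : HSpace K) : ⟪kerVec K x, f⟫_ℝ = f x := by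
  simp [kerVec]

theorem kerVec_apply (x y : X) : kerVec K y x = K x y := by
  rw [kerVec, RKHS.kerFun_apply (HSpace K), RKHS.OfKernel.kernel_ofKernel]
  simp [opKernel]

/-- The vector representing the QMC rule. -/
def qmcVec (P : Multiset X) : HSpace K := (Multiset.card P : ℝ)⁻¹ • (P.map (kerVec K)).sum

theorem inner_qmcVec (P : Multiset X) (f : HSpace K) : ⟪qmcVec K P, f⟫_ℝ = qmcRule P f := by
  have h : ∀ Q : Multiset X, ⟪(Q.map (kerVec K)).sum, f⟫_ℝ = (Q.map f).sum := by
    intro Q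
    induction Q using Multiset.induction_on with
    | empty => simp
    | cons a Q ih => simp [inner_add_left, ih, inner_kerVec_left]
  rw [qmcVec, real_inner_smul_left, h, qmcRule]
  ring

/-- Continuity makes the sections Bochner integrable, so that integration is represented by a vector
of `H(K)`. It follows by expanding `‖K_x - K_{x₀}‖²` with the reproducing property. -/
theorem continuous_kerVec [TopologicalSpace X] (hc : Continuous fun p : X × X => K p.1 p.2) :
    Continuous (kerVec K) := by
  rw [continuous_iff_continuousAt]
  intro x₀
  rw [ContinuousAt, tendsto_iff_norm_sub_tendsto_zero]
  have e : ∀ x, ‖kerVec K x - kerVec K x₀‖ = √(K x x - K x x₀ - K x₀ x + K x₀ x₀) := by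
    intro x
    have h : ‖kerVec K x - kerVec K x₀‖ ^ 2 = K x x - K x x₀ - K x₀ x + K x₀ x₀ := by
      rw [← real_inner_self_eq_norm_sq, inner_sub_left, inner_kerVec_left, inner_kerVec_left,
        RKHS.coe_sub]
      simp only [Pi.sub_apply, kerVec_apply]
      ring
    rw [← h, Real.sqrt_sq (norm_nonneg _)]
  simp_rw [e]
  have : Continuous fun x => √(K x x - K x x₀ - K x₀ x + K x₀ x₀) := by
    have h1 : Continuous fun x => K x x := hc.comp (by fun_prop : Continuous fun x => (x, x))
    have h2 : Continuous fun x => K x x₀ := hc.comp (by fun_prop : Continuous fun x => (x, x₀))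
    have h3 : Continuous fun x => K x₀ x := hc.comp (by fun_prop : Continuous fun x => (x₀, x))
    fun_prop
  simpa using this.tendsto x₀

/-- The error functional is represented by `ξ = qmcVec K P - J` with `J = ∫ K_x dx`, and the
worst-case error is `‖ξ‖`. By `h1` the function `J` is the constant `1`, which the rule integrates
exactly. So `ξ ⊥ J`, and only the pairing with the QMC vector contributes to `‖ξ‖²`. -/
theorem worstCaseError_sq [TopologicalSpace X] [CompactSpace X] [SecondCountableTopology X]
    [MeasureSpace X] [OpensMeasurableSpace X] [IsProbabilityMeasure (volume : Measure X)]
    (hc : Continuous fun p : X × X => K p.1 p.2) (h1 : ∀ x, ∫ y, K x y = 1)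
    {P : Multiset X} (hP : P ≠ 0) :
    worstCaseError (HSpace K) P ^ 2 =
      ENNReal.ofReal (qmcRule P (fun x => qmcRule P (fun y => K x y)) - 1) := by
  have hi : Integrable (kerVec K) (volume : Measure X) :=
    (continuous_kerVec K hc).integrable_of_hasCompactSupport (HasCompactSupport.of_compactSpace _)
  set J : HSpace K := ∫ x, kerVec K x with hJ
  have hJf : ∀ f : HSpace K, ⟪J, f⟫_ℝ = ∫ x, f x := by
    intro f
    rw [real_inner_comm, hJ, ← integral_inner hi]
    refine integral_congr_ae (.of_forall fun x => ?_)
    simp only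
    rw [real_inner_comm, inner_kerVec_left]
  have hJ1 : ∀ x, J x = 1 := by
    intro x
    rw [← inner_kerVec_left, real_inner_comm, hJf, ← h1 x]
    congr 1 with y
    rw [kerVec_apply, ← (Fact.out : K.PosSemidef).1.apply x y]
    simp
  set ξ : HSpace K := qmcVec K P - J with hξ
  have hξf : ∀ f : HSpace K, ⟪ξ, f⟫_ℝ = qmcRule P f - ∫ x, f x := by
    intro f
    rw [hξ, inner_sub_left, inner_qmcVec, hJf]
  have hξJ : ⟪ξ, J⟫_ℝ = 0 := by
    rw [hξf]
    have : (J : X → ℝ) = fun _ => 1 := funext hJ1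
    rw [this, qmcRule_const hP]
    simp
  have hξx : ∀ x, ξ x = qmcRule P (fun y => K x y) - 1 := by
    intro x
    rw [hξ, RKHS.coe_sub, Pi.sub_apply, hJ1, ← inner_kerVec_left, real_inner_comm, inner_qmcVec]
    congr 2 with y
    rw [kerVec_apply, ← (Fact.out : K.PosSemidef).1.apply x y]
    simp
  have hn : ‖ξ‖ ^ 2 = qmcRule P (fun x => qmcRule P (fun y => K x y)) - 1 := by
    rw [← real_inner_self_eq_norm_sq]
    nth_rewrite 2 [hξ]
    rw [inner_sub_right, hξJ, sub_zero, real_inner_comm, inner_qmcVec]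
    have : (ξ : X → ℝ) = fun x => qmcRule P (fun y => K x y) - 1 := funext hξx
    rw [this, qmcRule_sub, qmcRule_const hP]
  have hw : worstCaseError (HSpace K) P = ENNReal.ofReal ‖ξ‖ := by
    unfold worstCaseError
    apply le_antisymm
    · refine iSup_le fun f => ENNReal.ofReal_le_ofReal ?_
      rw [← hξf]
      calc |⟪ξ, (f : HSpace K)⟫_ℝ| ≤ ‖ξ‖ * ‖(f : HSpace K)‖ := abs_real_inner_le_norm _ _
        _ ≤ ‖ξ‖ := mul_le_of_le_one_right (norm_nonneg _) f.2
    -- The extremal function is the normalized representer; for `ξ = 0` the convention `0⁻¹ = 0`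
    -- makes it zero.
    · refine le_iSup_of_le ⟨‖ξ‖⁻¹ • ξ, ?_⟩ (ENNReal.ofReal_le_ofReal ?_)
      · rw [norm_smul, norm_inv, norm_norm]
        exact inv_mul_le_one
      · rw [← hξf, real_inner_smul_right, real_inner_self_eq_norm_sq]
        by_cases h0 : ‖ξ‖ = 0
        · simp [h0]
        · refine le_trans (le_of_eq ?_) (le_abs_self _)
          field_simp
  rw [hw, ← ENNReal.ofReal_pow (norm_nonneg _), hn]

end Rkhs

/-! ### Weighted sums of product kernels -/

/-- The weighted kernel `1 + ∑_u γ_u ∏_{j ∈ u} k(x_j, y_j)` built from a kernel in one variable. -/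
def prodKernel {s : ℕ} (γ : Finset (Fin s) → ℝ≥0) (k : Matrix I I ℝ) :
    Matrix (Cube s) (Cube s) ℝ :=
  Matrix.of fun x y => 1 + ∑ u ∈ (Finset.univ : Finset (Finset (Fin s))).erase ∅,
    (γ u : ℝ) * ∏ j ∈ u, k (x j) (y j)

theorem continuous_prodKernel {s : ℕ} (γ : Finset (Fin s) → ℝ≥0) {k : Matrix I I ℝ}
    (hk : Continuous fun p : I × I => k p.1 p.2) :
    Continuous fun p : Cube s × Cube s => prodKernel γ k p.1 p.2 := by
  simp only [prodKernel, Matrix.of_apply]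
  refine continuous_const.add (continuous_finsetSum _ fun u _ => continuous_const.mul
    (continuous_finsetProd _ fun j _ => ?_))
  exact hk.comp (by fun_prop : Continuous fun p : Cube s × Cube s => (p.1 j, p.2 j))

theorem integral_prodKernel {s : ℕ} (γ : Finset (Fin s) → ℝ≥0) {k : Matrix I I ℝ}
    (hk : Continuous fun p : I × I => k p.1 p.2) (h0 : ∀ x, ∫ y, k x y = 0) (x : Cube s) :
    ∫ y, prodKernel γ k x y = 1 := by
  have hkx : ∀ x, Continuous fun y => k x y := fun x =>
    hk.comp (by fun_prop : Continuous fun y : I => (x, y))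
  have hcont : ∀ u : Finset (Fin s),
      Continuous fun y : Cube s => (γ u : ℝ) * ∏ j ∈ u, k (x j) (y j) := fun u =>
    continuous_const.mul (continuous_finsetProd _ fun j _ => (hkx (x j)).comp (continuous_apply j))
  have hint : ∀ f : Cube s → ℝ, Continuous f → Integrable f := fun f hf =>
    hf.integrable_of_hasCompactSupport (HasCompactSupport.of_compactSpace _)
  simp only [prodKernel, Matrix.of_apply]
  rw [integral_add (integrable_const _)
    (hint _ (continuous_finsetSum _ fun u _ => hcont u)),
    integral_finsetSum _ fun u _ => hint _ (hcont u)]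
  rw [Finset.sum_eq_zero, add_zero]
  · simp
  intro u hu
  rw [integral_const_mul]
  -- Extending the product to all coordinates by factors `1` brings it into the form required by
  -- Fubini; one factor with `j ∈ u` then integrates to `0`.
  have e : ∀ y : Cube s, ∏ j ∈ u, k (x j) (y j) = ∏ j, if j ∈ u then k (x j) (y j) else 1 := by
    intro y
    rw [Finset.prod_ite_mem, Finset.univ_inter]
  simp_rw [e]
  rw [integral_fintype_prod_volume_eq_prod (fun j y => if j ∈ u then k (x j) y else 1)]
  obtain ⟨j, hj⟩ := Finset.nonempty_iff_ne_empty.mpr (Finset.ne_of_mem_erase hu)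
  rw [Finset.prod_eq_zero (Finset.mem_univ j), mul_zero]
  simp [hj, h0]

theorem continuous_bernoulliFun_abs_sub (n : ℕ) :
    Continuous fun p : I × I => bernoulliFun n |(p.1 : ℝ) - (p.2 : ℝ)| :=
  (continuous_bernoulliFun n).comp (by fun_prop)

theorem integral_unitInterval (f : ℝ → ℝ) : ∫ y : I, f y = ∫ y in (0 : ℝ)..1, f y := by
  rw [intervalIntegral.integral_of_le zero_le_one, ← integral_Icc_eq_integral_Ioc]
  exact integral_subtype measurableSet_Icc f

theorem integral_bernoulliFun_unitInterval {n : ℕ} (hn : n ≠ 0) :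
    ∫ y : I, bernoulliFun n (y : ℝ) = 0 := by
  rw [integral_unitInterval (bernoulliFun n), integral_bernoulliFun_eq_zero hn]

/-- For even `n`, `B_n(t) = B_n(1 - t)`. Hence the parts `y ≤ x` and `y ≥ x` become the integrals of
`B_n` over `[0,x]` and `[x,1]`, which together give the mean of `B_n`. -/
theorem integral_bernoulliFun_abs_sub {n : ℕ} (hn : n ≠ 0) (he : Even n) (x : I) :
    ∫ y : I, bernoulliFun n |(x : ℝ) - (y : ℝ)| = 0 := by
  rw [integral_unitInterval fun y => bernoulliFun n |(x : ℝ) - y|]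
  have hc : Continuous fun y => bernoulliFun n |(x : ℝ) - y| :=
    (continuous_bernoulliFun n).comp (by fun_prop)
  rw [← intervalIntegral.integral_add_adjacent_intervals (b := (x : ℝ))
    (hc.intervalIntegrable _ _) (hc.intervalIntegrable _ _)]
  have h1 : ∫ y in (0 : ℝ)..x, bernoulliFun n |(x : ℝ) - y| =
      ∫ y in (0 : ℝ)..x, bernoulliFun n y := by
    rw [intervalIntegral.integral_congr (g := fun y => bernoulliFun n ((x : ℝ) - y))]
    · rw [intervalIntegral.integral_comp_sub_left (bernoulliFun n)]
      simp
    · intro y hy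
      rw [Set.uIcc_of_le x.2.1] at hy
      simp only
      rw [abs_of_nonneg (sub_nonneg.mpr hy.2)]
  have h2 : ∫ y in (x : ℝ)..1, bernoulliFun n |(x : ℝ) - y| =
      ∫ y in (x : ℝ)..1, bernoulliFun n y := by
    rw [intervalIntegral.integral_congr (g := fun y => bernoulliFun n (1 + (x : ℝ) - y))]
    · rw [intervalIntegral.integral_comp_sub_left (bernoulliFun n)]
      simp
    · intro y hy
      rw [Set.uIcc_of_le x.2.2] at hy
      simp only
      rw [abs_of_nonpos (sub_nonpos.mpr hy.1), show 1 + (x : ℝ) - y = 1 - (-((x : ℝ) - y)) by ring,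
        bernoulliFun_eval_one_sub, he.neg_one_pow, one_mul]
  rw [h1, h2, intervalIntegral.integral_add_adjacent_intervals
    (intervalIntegrable_bernoulliFun _ _ _) (intervalIntegrable_bernoulliFun _ _ _),
    integral_bernoulliFun_eq_zero hn]

theorem continuous_sobOddKernelOne (α : ℕ) :
    Continuous fun p : I × I => sobOddKernelOne α p.1 p.2 := by
  simp only [sobOddKernelOne, Matrix.of_apply]
  refine (continuous_finsetSum _ fun τ _ => ?_).add ?_
  · refine (Continuous.mul ?_ ?_).div_const _
    · exact (continuous_bernoulliFun τ).comp (by fun_prop)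
    · exact (continuous_bernoulliFun τ).comp (by fun_prop)
  · exact (continuous_const.mul (continuous_bernoulliFun_abs_sub _)).div_const _

theorem integral_sobOddKernelOne {α : ℕ} (hα : α ≠ 0) (x : I) :
    ∫ y, sobOddKernelOne α x y = 0 := by
  have hint : ∀ f : I → ℝ, Continuous f → Integrable f := fun f hf =>
    hf.integrable_of_hasCompactSupport (HasCompactSupport.of_compactSpace _)
  have hB : ∀ n, Continuous fun y : I => bernoulliFun n (y : ℝ) := fun n =>
    (continuous_bernoulliFun n).comp (by fun_prop)
  simp only [sobOddKernelOne, Matrix.of_apply]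
  rw [integral_add, integral_finsetSum]
  · rw [integral_div, integral_const_mul, integral_bernoulliFun_abs_sub (by omega) (by simp),
      mul_zero, zero_div, add_zero]
    refine Finset.sum_eq_zero fun τ hτ => ?_
    rw [integral_div, integral_const_mul, integral_bernoulliFun_unitInterval, mul_zero, zero_div]
    simp only [Finset.mem_filter, Finset.mem_Icc] at hτ
    omega
  · exact fun τ _ => hint _ ((continuous_const.mul (hB τ)).div_const _)
  · exact hint _ (continuous_finsetSum _ fun τ _ => (continuous_const.mul (hB τ)).div_const _)
  · refine hint _ ((continuous_const.mul ?_).div_const _)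
    exact (continuous_bernoulliFun _).comp (by fun_prop)

/-! ### Sums of products over integer vectors -/

/-- Absolute summability is carried through the induction because multiplying the series of the
first coordinate with the rest requires it. -/
theorem hasSum_pi_prod {ι : Type*} {s : ℕ} {f : Fin s → ι → ℂ} {S : Fin s → ℂ}
    (hS : ∀ j, HasSum (f j) (S j)) (hf : ∀ j, Summable fun i => ‖f j i‖) :
    HasSum (fun h : Fin s → ι => ∏ j, f j (h j)) (∏ j, S j) ∧
      Summable fun h : Fin s → ι => ‖∏ j, f j (h j)‖ := by
  induction s with
  | zero =>
    constructor
    · simp only [Finset.univ_eq_empty, Finset.prod_empty]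
      exact hasSum_unique fun h : Fin 0 → ι => (1 : ℂ)
    · exact (hasSum_unique fun h : Fin 0 → ι => ‖∏ j, f j (h j)‖).summable
  | succ s ih =>
    obtain ⟨h1, h2⟩ := ih (fun j : Fin s => hS j.succ) fun j => hf j.succ
    have e : ∀ p : ι × (Fin s → ι), ∏ j, f j (Fin.consEquiv (fun _ => ι) p j) =
        f 0 p.1 * ∏ j : Fin s, f j.succ (p.2 j) := by
      intro p
      simp [Fin.prod_univ_succ, Fin.consEquiv]
    have k1 : HasSum (fun p : ι × (Fin s → ι) => f 0 p.1 * ∏ j : Fin s, f j.succ (p.2 j))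
        (S 0 * ∏ j : Fin s, S j.succ) :=
      HasSum.mul (f := f 0) (g := fun h : Fin s → ι => ∏ j : Fin s, f j.succ (h j)) (hS 0) h1
        (summable_mul_of_summable_norm (f := f 0)
          (g := fun h : Fin s → ι => ∏ j : Fin s, f j.succ (h j)) (hf 0) h2)
    have k2 : Summable fun p : ι × (Fin s → ι) => ‖f 0 p.1 * ∏ j : Fin s, f j.succ (p.2 j)‖ :=
      Summable.mul_norm (f := f 0) (g := fun h : Fin s → ι => ∏ j : Fin s, f j.succ (h j))
        (hf 0) h2
    simp only [← e] at k1 k2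
    constructor
    · rw [Fin.prod_univ_succ]
      exact (Equiv.hasSum_iff (f := fun h : Fin (s + 1) → ι => ∏ j, f j (h j))
        (Fin.consEquiv fun _ => ι)).mp k1
    · exact (Equiv.summable_iff (f := fun h : Fin (s + 1) → ι => ‖∏ j, f j (h j)‖)
        (Fin.consEquiv fun _ => ι)).mp k2

theorem ennreal_tsum_pi_prod {ι : Type*} :
    ∀ {s : ℕ} (f : Fin s → ι → ℝ≥0∞), ∑' h : Fin s → ι, ∏ j, f j (h j) = ∏ j, ∑' i, f j i
  | 0, f => by simp [tsum_fintype]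
  | s + 1, f => by
    rw [← (Fin.consEquiv fun _ => ι).tsum_eq, Fin.prod_univ_succ,
      ← ennreal_tsum_pi_prod fun j => f j.succ, ← ENNReal.tsum_mul_right, ENNReal.tsum_prod']
    refine tsum_congr fun i => ?_
    rw [← ENNReal.tsum_mul_left]
    refine tsum_congr fun h => ?_
    simp [Fin.prod_univ_succ, Fin.consEquiv]

/-! ### Fourier series of Bernoulli polynomials -/

/-- The character `θ ↦ e^{2πiθ}`. -/
def cexp (θ : ℝ) : ℂ := Complex.exp (2 * Real.pi * Complex.I * θ)

theorem cexp_add (θ η : ℝ) : cexp (θ + η) = cexp θ * cexp η := by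
  rw [cexp, cexp, cexp, ← Complex.exp_add]
  push_cast
  ring_nf

theorem cexp_sum {ι : Type*} (t : Finset ι) (θ : ι → ℝ) :
    cexp (∑ j ∈ t, θ j) = ∏ j ∈ t, cexp (θ j) := by
  simp only [cexp]
  rw [← Complex.exp_sum]
  push_cast
  rw [Finset.mul_sum]

theorem cexp_int (n : ℤ) : cexp n = 1 := by
  rw [cexp, Complex.exp_eq_one_iff]
  exact ⟨n, by push_cast; ring⟩

theorem cexp_add_int (θ : ℝ) (n : ℤ) : cexp (θ + n) = cexp θ := by
  rw [cexp_add, cexp_int, mul_one]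

theorem cexp_nat_mul (k : ℕ) (θ : ℝ) : cexp (k * θ) = cexp θ ^ k := by
  rw [cexp, cexp, ← Complex.exp_nat_mul]
  push_cast
  ring_nf

theorem cexp_eq_ofReal_mul_I (θ : ℝ) :
    cexp θ = Complex.exp ((2 * Real.pi * θ : ℝ) * Complex.I) := by
  rw [cexp]
  push_cast
  ring_nf

theorem norm_cexp (θ : ℝ) : ‖cexp θ‖ = 1 := by
  rw [cexp_eq_ofReal_mul_I, Complex.norm_exp_ofReal_mul_I]

theorem cexp_re (θ : ℝ) : (cexp θ).re = Real.cos (2 * Real.pi * θ) := by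
  rw [cexp_eq_ofReal_mul_I, Complex.exp_ofReal_mul_I_re]

/-- The decay `|h|^{-a}` of the Fourier weights; it vanishes at `h = 0` when `a ≠ 0`. -/
def decay (a : ℕ) (h : ℤ) : ℝ := |(h : ℝ)| ^ (-(a : ℝ))

theorem decay_nonneg (a : ℕ) (h : ℤ) : 0 ≤ decay a h := by unfold decay; positivity

theorem decay_zero {a : ℕ} (ha : a ≠ 0) : decay a 0 = 0 := by
  have : -(a : ℝ) ≠ 0 := by simpa using ha
  simp [decay, Real.zero_rpow this]

theorem decay_neg (a : ℕ) (h : ℤ) : decay a (-h) = decay a h := by simp [decay]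

theorem summable_decay {a : ℕ} (ha : 2 ≤ a) : Summable (decay a) :=
  Real.summable_abs_int_rpow (by exact_mod_cast ha)

theorem decay_eq_of_even {a : ℕ} (he : Even a) (h : ℤ) : decay a h = 1 / (h : ℝ) ^ a := by
  rw [decay, Real.rpow_neg (abs_nonneg _), Real.rpow_natCast, he.pow_abs, one_div]

/-- The periodic function `∑_{h ≠ 0} |h|^{-a} e^{2πiht}` on `[0,1]`, in closed form. -/
def bernoulliSeries (a : ℕ) (t : ℝ) : ℝ :=
  (-1) ^ (a / 2 + 1) * (2 * Real.pi) ^ a / (a.factorial : ℝ) * bernoulliFun a t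

theorem hasSum_decay_of_mem_Icc {a : ℕ} (ha : 2 ≤ a) (he : Even a) {t : ℝ}
    (ht : t ∈ Set.Icc (0 : ℝ) 1) :
    HasSum (fun h : ℤ => (decay a h : ℂ) * cexp (h * t)) (bernoulliSeries a t : ℂ) := by
  convert hasSum_one_div_pow_mul_fourier_mul_bernoulliFun ha ht using 1
  · ext h
    rw [decay_eq_of_even he, fourier_coe_apply, cexp]
    push_cast
    congr 2
    ring
  · obtain ⟨m, rfl⟩ := he
    rw [bernoulliSeries, ← two_mul, Nat.mul_div_cancel_left _ two_pos]
    push_cast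
    rw [mul_pow _ Complex.I, pow_mul Complex.I, Complex.I_sq, pow_succ]
    ring

theorem hasSum_decay_abs {a : ℕ} (ha : 2 ≤ a) (he : Even a) {t : ℝ} (ht : |t| ≤ 1) :
    HasSum (fun h : ℤ => (decay a h : ℂ) * cexp (h * t)) (bernoulliSeries a |t| : ℂ) := by
  rcases le_total 0 t with h0 | h0
  · rw [abs_of_nonneg h0] at ht ⊢
    exact hasSum_decay_of_mem_Icc ha he ⟨h0, ht⟩
  · rw [abs_of_nonpos h0] at ht ⊢
    rw [← (Equiv.neg ℤ).hasSum_iff]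
    convert hasSum_decay_of_mem_Icc ha he (t := -t) ⟨by linarith, ht⟩ using 2 with h
    simp [decay_neg]

theorem summable_norm_decay_mul_cexp {a : ℕ} (ha : 2 ≤ a) (t : ℝ) :
    Summable fun h : ℤ => ‖(decay a h : ℂ) * cexp (h * t)‖ := by
  simp only [norm_mul, norm_cexp, mul_one, Complex.norm_real,
    Real.norm_of_nonneg (decay_nonneg _ _)]
  exact summable_decay ha

/-! ### Fourier series of the weighted kernels -/

/-- As `u` varies with `h` fixed, only `u = supp h` survives. This converts a sum over `u` of
products of one-variable series into one series over `h`. -/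
theorem prod_ite_support {s : ℕ} {M : Type*} [CommMonoidWithZero M] (u : Finset (Fin s))
    (h : Fin s → ℤ) (f : Fin s → M) (hf : ∀ j, h j = 0 → f j = 0) :
    (∏ j, if j ∈ u then f j else if h j = 0 then 1 else 0) =
      if u = ({j | h j ≠ 0} : Finset (Fin s)) then ∏ j with h j ≠ 0, f j else 0 := by
  split_ifs with hu
  · subst hu
    rw [Finset.prod_filter]
    refine Finset.prod_congr rfl fun j _ => ?_
    by_cases hj : h j = 0 <;> simp [hj]
  · have : ∃ j, ¬ (j ∈ u ↔ h j ≠ 0) := by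
      by_contra! hc
      exact hu (Finset.ext fun j => by simp [hc j])
    obtain ⟨j, hj⟩ := this
    refine Finset.prod_eq_zero (Finset.mem_univ j) ?_
    by_cases hju : j ∈ u
    · simp only [hju, true_iff, not_not, if_true] at hj ⊢
      exact hf j hj
    · simp only [hju, false_iff, not_not, if_false] at hj ⊢
      simp [hj]

/-- The weights with the weight of the empty set replaced by `1`. -/
def unitWeights {s : ℕ} (w : Finset (Fin s) → ℝ≥0) (u : Finset (Fin s)) : ℝ≥0 :=
  if u = ∅ then 1 else w u

theorem sum_unitWeights {s : ℕ} (w : Finset (Fin s) → ℝ≥0) (f : Finset (Fin s) → ℝ)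
    (hf : f ∅ = 1) : ∑ u, (unitWeights w u : ℝ) * f u =
      1 + ∑ u ∈ (Finset.univ : Finset (Finset (Fin s))).erase ∅, (w u : ℝ) * f u := by
  rw [← Finset.add_sum_erase _ _ (Finset.mem_univ ∅)]
  congr 1
  · simp [unitWeights, hf]
  · refine Finset.sum_congr rfl fun u hu => ?_
    rw [unitWeights, if_neg (Finset.ne_of_mem_erase hu)]

theorem korobovWeight_half {s : ℕ} (a : ℕ) (w : Finset (Fin s) → ℝ≥0) (h : Fin s → ℤ) :
    korobovWeight ((a : ℝ) / 2) w h =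
      unitWeights w {j | h j ≠ 0} * ∏ j with h j ≠ 0, decay a (h j) := by
  have e : -2 * ((a : ℝ) / 2) = -a := by ring
  by_cases h0 : h = 0
  · simp [korobovWeight, unitWeights, h0]
  · have : ({j | h j ≠ 0} : Finset (Fin s)) ≠ ∅ := by
      obtain ⟨j, hj⟩ := Function.ne_iff.mp h0
      exact Finset.ne_empty_of_mem (a := j) (by simpa using hj)
    rw [korobovWeight, if_neg h0, unitWeights, if_neg this, e]
    rfl

/-- Grouping the frequencies by their support `u` factors each group into one-variable series over
nonzero integers. The zero frequency needs no separate exclusion for `j ∈ u` because `decay a 0 =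
0`. -/
theorem hasSum_korobovWeight {s a : ℕ} (ha : 2 ≤ a) (he : Even a) (w : Finset (Fin s) → ℝ≥0)
    {t : Fin s → ℝ} (ht : ∀ j, |t j| ≤ 1) :
    HasSum (fun h : Fin s → ℤ =>
      (korobovWeight ((a : ℝ) / 2) w h : ℂ) * cexp (∑ j, (h j : ℝ) * t j))
      ((1 + ∑ u ∈ (Finset.univ : Finset (Finset (Fin s))).erase ∅,
        (w u : ℝ) * ∏ j ∈ u, bernoulliSeries a |t j| : ℝ) : ℂ) := by
  rw [← sum_unitWeights w (fun u => ∏ j ∈ u, bernoulliSeries a |t j|) Finset.prod_empty]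
  have hu : ∀ u : Finset (Fin s), HasSum (fun h : Fin s → ℤ => ∏ j, if j ∈ u then
      (decay a (h j) : ℂ) * cexp (h j * t j) else if h j = 0 then 1 else 0)
      ((∏ j ∈ u, bernoulliSeries a |t j| : ℝ) : ℂ) := by
    intro u
    have := (hasSum_pi_prod (s := s) (f := fun j (i : ℤ) => if j ∈ u then
      (decay a i : ℂ) * cexp (i * t j) else if i = 0 then 1 else 0)
      (S := fun j => if j ∈ u then (bernoulliSeries a |t j| : ℂ) else 1) (fun j => ?_)
      (fun j => ?_)).1
    · convert! this using 1
      rw [Finset.prod_ite_mem, Finset.univ_inter]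
      push_cast
      rfl
    · by_cases hj : j ∈ u
      · simp only [hj, if_true]
        exact hasSum_decay_abs ha he (ht j)
      · simp only [hj, if_false]
        exact hasSum_ite_eq 0 1
    · by_cases hj : j ∈ u
      · simp only [hj, if_true]
        exact summable_norm_decay_mul_cexp ha _
      · simp only [hj, if_false]
        refine summable_of_ne_finset_zero (s := {0}) fun i hi => ?_
        simp at hi
        simp [hi]
  have := hasSum_sum (s := Finset.univ) fun u _ => (hu u).mul_left (unitWeights w u : ℂ)
  convert! this using 1
  · ext h
    have e : ∀ u : Finset (Fin s), _ := fun u => prod_ite_support u h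
      (fun j => (decay a (h j) : ℂ) * cexp (h j * t j)) fun j hj => by
        rw [hj, decay_zero (by omega)]; simp
    simp only [e]
    simp only [mul_ite, mul_zero, Finset.sum_ite_eq', Finset.mem_univ, if_true]
    rw [korobovWeight_half, Finset.prod_mul_distrib, ← cexp_sum]
    push_cast
    rw [mul_assoc]
    congr 3
    rw [Finset.sum_filter]
    refine Finset.sum_congr rfl fun j _ => ?_
    by_cases hj : h j = 0 <;> simp [hj]
  · push_cast
    rfl

/-- The kernel `∑_{h ≠ 0} |h|^{-a} e^{2πih(x-y)}` in one variable. -/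
def korobovKernelOne (a : ℕ) : Matrix I I ℝ :=
  Matrix.of fun x y => bernoulliSeries a |(x : ℝ) - (y : ℝ)|

theorem abs_sub_le_one (x y : I) : |(x : ℝ) - (y : ℝ)| ≤ 1 :=
  abs_le.mpr ⟨by linarith [x.2.1, y.2.2], by linarith [x.2.2, y.2.1]⟩

theorem korobovKernel_eq_prodKernel {s a : ℕ} (ha : 2 ≤ a) (he : Even a)
    (w : Finset (Fin s) → ℝ≥0) :
    korobovKernel ((a : ℝ) / 2) w = prodKernel w (korobovKernelOne a) := by
  ext x y
  have := hasSum_korobovWeight ha he w (t := fun j => (x j : ℝ) - y j)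
    fun j => abs_sub_le_one (x j) (y j)
  rw [korobovKernel, Matrix.of_apply, prodKernel, Matrix.of_apply]
  simp only [korobovKernelOne, Matrix.of_apply]
  rw [← Complex.ofReal_re (1 + _), ← this.tsum_eq]
  congr 2
  ext h
  rw [cexp]
  push_cast
  rfl

theorem continuous_korobovKernelOne (a : ℕ) :
    Continuous fun p : I × I => korobovKernelOne a p.1 p.2 := by
  simp only [korobovKernelOne, Matrix.of_apply, bernoulliSeries]
  exact continuous_const.mul (continuous_bernoulliFun_abs_sub a)

theorem integral_korobovKernelOne {a : ℕ} (ha : a ≠ 0) (he : Even a) (x : I) :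
    ∫ y, korobovKernelOne a x y = 0 := by
  simp only [korobovKernelOne, Matrix.of_apply, bernoulliSeries]
  rw [integral_const_mul, integral_bernoulliFun_abs_sub ha he, mul_zero]

/-! ### Characters on lattice points -/

theorem qmcRule_add {X : Type*} (P : Multiset X) (f g : X → ℝ) :
    qmcRule P (fun x => f x + g x) = qmcRule P f + qmcRule P g := by
  simp [qmcRule, Multiset.sum_map_add, add_div]

theorem qmcRule_mul_left {X : Type*} (P : Multiset X) (c : ℝ) (f : X → ℝ) :
    qmcRule P (fun x => c * f x) = c * qmcRule P f := by
  simp [qmcRule, Multiset.sum_map_mul_left, mul_div_assoc]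

theorem qmcRule_mul_right {X : Type*} (P : Multiset X) (c : ℝ) (f : X → ℝ) :
    qmcRule P (fun x => f x * c) = qmcRule P f * c := by
  simp_rw [mul_comm _ c, qmcRule_mul_left]

theorem qmcRule_sum {X ι : Type*} (P : Multiset X) (t : Finset ι) (f : ι → X → ℝ) :
    qmcRule P (fun x => ∑ i ∈ t, f i x) = ∑ i ∈ t, qmcRule P (f i) := by
  classical
  induction t using Finset.induction_on with
  | empty => simp [qmcRule]
  | insert i t hi ih => simp_rw [Finset.sum_insert hi, qmcRule_add, ih]

theorem hasSum_qmcRule {X ι : Type*} (P : Multiset X) {f : ι → X → ℝ} {S : X → ℝ}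
    (h : ∀ x, HasSum (fun i => f i x) (S x)) :
    HasSum (fun i => qmcRule P (f i)) (qmcRule P S) := by
  unfold qmcRule
  refine HasSum.div_const ?_ _
  induction P using Multiset.induction_on with
  | empty => simp
  | cons a P ih =>
    simp only [Multiset.map_cons, Multiset.sum_cons]
    exact (h a).add ih

/-- Membership of an integer vector in the dual lattice. -/
def InDual {s : ℕ} (N : ℕ) (z : Fin s → ℕ) (h : Fin s → ℤ) : Prop :=
  (N : ℤ) ∣ ∑ j, h j * (z j : ℤ)

instance {s : ℕ} (N : ℕ) (z : Fin s → ℕ) : DecidablePred (InDual N z) :=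
  fun _ => by unfold InDual; infer_instance

theorem sum_cexp_pow {N : ℕ} (hN : N ≠ 0) (m : ℤ) :
    ∑ n ∈ Finset.range N, cexp ((m : ℝ) / N) ^ n = if (N : ℤ) ∣ m then (N : ℂ) else 0 := by
  have hN' : (N : ℝ) ≠ 0 := by exact_mod_cast hN
  split_ifs with hm
  · obtain ⟨k, rfl⟩ := hm
    have : (((N : ℤ) * k : ℤ) : ℝ) / N = (k : ℝ) := by
      push_cast
      field_simp
    simp only [this, cexp_int, one_pow, Finset.sum_const, Finset.card_range, nsmul_eq_mul, mul_one]
  · have hne : cexp ((m : ℝ) / N) ≠ 1 := by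
      intro hc
      rw [cexp, Complex.exp_eq_one_iff] at hc
      obtain ⟨k, hk⟩ := hc
      apply hm
      refine ⟨k, ?_⟩
      have h2 : (2 * Real.pi * Complex.I : ℂ) ≠ 0 := Complex.two_pi_I_ne_zero
      rw [mul_comm] at hk
      have h3 := mul_right_cancel₀ h2 hk
      have h4 : (m : ℝ) / N = k := by exact_mod_cast h3
      rw [div_eq_iff hN'] at h4
      have : (m : ℝ) = ((N * k : ℤ) : ℝ) := by push_cast; rw [h4]; ring
      exact_mod_cast this
    rw [geom_sum_eq hne, ← cexp_nat_mul]
    have : (N : ℝ) * ((m : ℝ) / N) = (m : ℤ) := by field_simp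
    rw [this, cexp_int]
    simp

theorem cexp_latticePoint {s : ℕ} {N : ℕ} (z : Fin s → ℕ) (h : Fin s → ℤ) (n : ℕ) :
    cexp (∑ j, (h j : ℝ) * Int.fract ((n : ℝ) * (z j : ℝ) / (N : ℝ))) =
      cexp (((∑ j, h j * (z j : ℤ) : ℤ) : ℝ) / N) ^ n := by
  rw [← cexp_nat_mul, ← cexp_add_int _ (∑ j, h j * ⌊(n : ℝ) * (z j : ℝ) / (N : ℝ)⌋)]
  congr 1
  push_cast
  rw [← Finset.sum_add_distrib, Finset.sum_div, Finset.mul_sum]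
  refine Finset.sum_congr rfl fun j _ => ?_
  rw [← mul_add, Int.fract_add_floor]
  ring

theorem sum_cexp_latticePoint {s : ℕ} {N : ℕ} (hN : N ≠ 0) (z : Fin s → ℕ) (h : Fin s → ℤ) :
    ∑ n ∈ Finset.range N, cexp (∑ j, (h j : ℝ) * Int.fract ((n : ℝ) * (z j : ℝ) / (N : ℝ))) =
      if InDual N z h then (N : ℂ) else 0 := by
  simp_rw [cexp_latticePoint, sum_cexp_pow hN]
  rfl

/-- The `n`-th point of the lattice point set. -/
def latticePoint {s : ℕ} (N : ℕ) (z : Fin s → ℕ) (n : ℕ) : Cube s := fun j =>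
  ⟨Int.fract ((n : ℝ) * (z j : ℝ) / (N : ℝ)), Int.fract_nonneg _, (Int.fract_lt_one _).le⟩

theorem latticePoints_eq_map {s : ℕ} (N : ℕ) (z : Fin s → ℕ) :
    latticePoints N z = (Multiset.range N).map (latticePoint N z) := by
  unfold latticePoints
  -- In `latticePoints` the index multiset is coerced to real numbers through the monad structure of
  -- `Multiset`; the coercion is turned into a `map` and fused with the outer one.
  rw [bind_pure_comp, Multiset.fmap_def, Multiset.map_map]
  rfl

theorem qmcRule_latticePoints {s : ℕ} (N : ℕ) (z : Fin s → ℕ) (f : Cube s → ℝ) :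
    qmcRule (latticePoints N z) f =
      (∑ n ∈ Finset.range N, f (latticePoint N z n)) / N := by
  rw [qmcRule, latticePoints_eq_map, Multiset.map_map, Multiset.card_map, Multiset.card_range]
  rfl

theorem latticePoints_ne_zero {s : ℕ} {N : ℕ} (hN : N ≠ 0) (z : Fin s → ℕ) :
    latticePoints N z ≠ 0 := by
  rw [ne_eq, ← Multiset.card_eq_zero, latticePoints_eq_map, Multiset.card_map, Multiset.card_range]
  exact hN

theorem cexp_im (θ : ℝ) : (cexp θ).im = Real.sin (2 * Real.pi * θ) := by
  rw [cexp_eq_ofReal_mul_I, Complex.exp_ofReal_mul_I_im]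

theorem qmcRule_cos {s : ℕ} {N : ℕ} (hN : N ≠ 0) (z : Fin s → ℕ) (h : Fin s → ℤ) :
    qmcRule (latticePoints N z)
      (fun x => Real.cos (2 * Real.pi * ∑ j, (h j : ℝ) * (x j : ℝ))) =
        if InDual N z h then 1 else 0 := by
  have hN' : (N : ℝ) ≠ 0 := by exact_mod_cast hN
  have := congrArg Complex.re (sum_cexp_latticePoint hN z h)
  rw [Complex.re_sum] at this
  simp only [cexp_re] at this
  simp only [qmcRule_latticePoints, latticePoint, this]
  split_ifs <;> simp [hN']

theorem qmcRule_sin {s : ℕ} {N : ℕ} (hN : N ≠ 0) (z : Fin s → ℕ) (h : Fin s → ℤ) :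
    qmcRule (latticePoints N z)
      (fun x => Real.sin (2 * Real.pi * ∑ j, (h j : ℝ) * (x j : ℝ))) = 0 := by
  have := congrArg Complex.im (sum_cexp_latticePoint hN z h)
  rw [Complex.im_sum] at this
  simp only [cexp_im] at this
  simp only [qmcRule_latticePoints, latticePoint, this]
  split_ifs <;> simp

/-- By the addition formula the double average is the squared cosine average plus the squared sine
average. The latter is `0`, and the former equals its own square root, being `0` or `1`. -/
theorem qmcRule_cos_sub {s : ℕ} {N : ℕ} (hN : N ≠ 0) (z : Fin s → ℕ) (h : Fin s → ℤ) :
    qmcRule (latticePoints N z) (fun x => qmcRule (latticePoints N z) fun y =>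
      Real.cos (2 * Real.pi * ∑ j, (h j : ℝ) * ((x j : ℝ) - (y j : ℝ)))) =
        if InDual N z h then 1 else 0 := by
  simp_rw [mul_sub, Finset.sum_sub_distrib, mul_sub, Real.cos_sub, qmcRule_add, qmcRule_mul_left,
    qmcRule_mul_right, qmcRule_cos hN, qmcRule_sin hN]
  split_ifs <;> simp

/-! ### The worst-case error of lattice rules in Korobov spaces -/

theorem hasSum_korobovWeight_cos {s a : ℕ} (ha : 2 ≤ a) (he : Even a) (w : Finset (Fin s) → ℝ≥0)
    {t : Fin s → ℝ} (ht : ∀ j, |t j| ≤ 1) :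
    HasSum (fun h : Fin s → ℤ =>
      korobovWeight ((a : ℝ) / 2) w h * Real.cos (2 * Real.pi * ∑ j, (h j : ℝ) * t j))
      (1 + ∑ u ∈ (Finset.univ : Finset (Finset (Fin s))).erase ∅,
        (w u : ℝ) * ∏ j ∈ u, bernoulliSeries a |t j|) := by
  have := Complex.hasSum_re (hasSum_korobovWeight ha he w ht)
  rw [Complex.ofReal_re] at this
  simpa only [Complex.re_ofReal_mul, cexp_re] using this

theorem hasSum_dual_kernel {s a N : ℕ} (ha : 2 ≤ a) (he : Even a) (hN : N ≠ 0)
    (w : Finset (Fin s) → ℝ≥0) (z : Fin s → ℕ) :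
    HasSum (fun h : Fin s → ℤ =>
      korobovWeight ((a : ℝ) / 2) w h * if InDual N z h then 1 else 0)
      (qmcRule (latticePoints N z) fun x => qmcRule (latticePoints N z) fun y =>
        korobovKernel ((a : ℝ) / 2) w x y) := by
  have := hasSum_qmcRule (latticePoints N z) fun x => hasSum_qmcRule (latticePoints N z) fun y =>
    hasSum_korobovWeight_cos ha he w (t := fun j => (x j : ℝ) - y j)
      fun j => abs_sub_le_one (x j) (y j)
  simp only [qmcRule_mul_left, qmcRule_cos_sub hN] at this
  rw [korobovKernel_eq_prodKernel ha he]
  exact this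

/-- The average over the lattice points of `∏_{j ∈ u} ∑_{h ≠ 0} |h|^{-a} e^{2πihx_j}`. -/
def seriesAverage {s : ℕ} (a N : ℕ) (z : Fin s → ℕ) (u : Finset (Fin s)) : ℝ :=
  qmcRule (latticePoints N z) fun x => ∏ j ∈ u, bernoulliSeries a (x j)

/-- The series has the same terms as in `hasSum_dual_kernel`, so uniqueness of sums replaces the
average over pairs by an average over single points. This is the group structure of the lattice at
work. -/
theorem hasSum_dual_average {s a N : ℕ} (ha : 2 ≤ a) (he : Even a) (hN : N ≠ 0)
    (w : Finset (Fin s) → ℝ≥0) (z : Fin s → ℕ) :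
    HasSum (fun h : Fin s → ℤ =>
      korobovWeight ((a : ℝ) / 2) w h * if InDual N z h then 1 else 0)
      (1 + ∑ u ∈ (Finset.univ : Finset (Finset (Fin s))).erase ∅,
        (w u : ℝ) * seriesAverage a N z u) := by
  have habs : ∀ x : I, |(x : ℝ)| = x := fun x => abs_of_nonneg x.2.1
  have := hasSum_qmcRule (latticePoints N z) fun x =>
    hasSum_korobovWeight_cos ha he w (t := fun j => (x j : ℝ)) fun j => (habs (x j)).trans_le (x j).2.2
  simp only [qmcRule_mul_left, qmcRule_cos hN, habs, qmcRule_add, qmcRule_sum,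
    qmcRule_const (latticePoints_ne_zero hN z)] at this
  exact this

/-- With all weight placed on `u`, the sum over the dual lattice is `1 + S_u`, and its term at `h =
0` is already `1`. -/
theorem seriesAverage_nonneg {s a N : ℕ} (ha : 2 ≤ a) (he : Even a) (hN : N ≠ 0)
    (z : Fin s → ℕ) {u : Finset (Fin s)} (hu : u ≠ ∅) : 0 ≤ seriesAverage a N z u := by
  have h := hasSum_dual_average ha he hN (fun v => if v = u then 1 else 0) z
  have h0 := le_hasSum h 0 fun h _ => mul_nonneg (korobovWeight_nonneg _ _ _) (by split_ifs <;> simp)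
  have hd : InDual N z 0 := by simp [InDual]
  rw [if_pos hd, Finset.sum_eq_single u] at h0
  · simpa [korobovWeight] using h0
  · intro v _ hv
    simp [hv]
  · intro hc
    exact absurd (Finset.mem_erase.mpr ⟨hu, Finset.mem_univ u⟩) hc

theorem worstCaseError_korobov_sq_eq_ofReal {s a N : ℕ} (ha : 2 ≤ a) (he : Even a) (hN : N ≠ 0)
    (w : Finset (Fin s) → ℝ≥0) (z : Fin s → ℕ) :
    worstCaseError (KorobovSpace ((a : ℝ) / 2) w) (latticePoints N z) ^ 2 =
      ENNReal.ofReal (∑ u ∈ (Finset.univ : Finset (Finset (Fin s))).erase ∅,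
        (w u : ℝ) * seriesAverage a N z u) := by
  rw [worstCaseError_sq _ _ _ (latticePoints_ne_zero hN z),
    (hasSum_dual_kernel ha he hN w z).unique (hasSum_dual_average ha he hN w z), add_sub_cancel_left]
  · rw [korobovKernel_eq_prodKernel ha he]
    exact continuous_prodKernel w (continuous_korobovKernelOne a)
  · rw [korobovKernel_eq_prodKernel ha he]
    exact integral_prodKernel w (continuous_korobovKernelOne a)
      (integral_korobovKernelOne (by omega) he)

theorem worstCaseError_korobov_sq_eq_tsum {s a N : ℕ} (ha : 2 ≤ a) (he : Even a) (hN : N ≠ 0)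
    (w : Finset (Fin s) → ℝ≥0) (z : Fin s → ℕ) :
    worstCaseError (KorobovSpace ((a : ℝ) / 2) w) (latticePoints N z) ^ 2 =
      ∑' h : Fin s → ℤ, if h ≠ 0 ∧ InDual N z h then
        ENNReal.ofReal (korobovWeight ((a : ℝ) / 2) w h) else 0 := by
  have h1 := hasSum_ite_sub_hasSum (hasSum_dual_average ha he hN w z) 0
  have hd : InDual N z 0 := by simp [InDual]
  rw [if_pos hd, korobovWeight, if_pos rfl, mul_one, add_sub_cancel_left] at h1
  rw [worstCaseError_korobov_sq_eq_ofReal ha he hN, ← h1.tsum_eq,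
    ENNReal.ofReal_tsum_of_nonneg _ h1.summable]
  · refine tsum_congr fun h => ?_
    by_cases h0 : h = 0 <;> by_cases hh : InDual N z h <;> simp [h0, hh]
  · intro h
    have := korobovWeight_nonneg ((a : ℝ) / 2) w h
    split_ifs <;> simp [this]

/-! ### Kernels with nonnegative coefficients in cosine series -/

/-- The cosine `cos(2πhx)`. -/
def cosFun (h : ℤ) (x : I) : ℝ := Real.cos (2 * Real.pi * ((h : ℝ) * (x : ℝ)))

theorem cosFun_zero (x : I) : cosFun 0 x = 1 := by simp [cosFun]

theorem cosFun_neg (h : ℤ) (x : I) : cosFun (-h) x = cosFun h x := by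
  simp [cosFun]

/-- The kernel is a double cosine series with nonnegative coefficients. -/
def IsCosPositive (F : I → I → ℝ) : Prop :=
  ∃ b : ℤ × ℤ → ℝ, (∀ p, 0 ≤ b p) ∧
    ∀ x y, HasSum (fun p : ℤ × ℤ => b p * (cosFun p.1 x * cosFun p.2 y)) (F x y)

theorem isCosPositive_one : IsCosPositive fun _ _ => 1 := by
  refine ⟨fun p => if p = (0, 0) then 1 else 0, fun p => by dsimp only; split_ifs <;> simp,
    fun x y => ?_⟩
  convert! hasSum_ite_eq ((0, 0) : ℤ × ℤ) (1 : ℝ) using 2 with p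
  split_ifs with hp
  · simp [hp, cosFun_zero]
  · simp only [if_neg hp, zero_mul]

theorem IsCosPositive.add {F G : I → I → ℝ} (hF : IsCosPositive F) (hG : IsCosPositive G) :
    IsCosPositive fun x y => F x y + G x y := by
  obtain ⟨b, hb, hF⟩ := hF
  obtain ⟨c, hc, hG⟩ := hG
  refine ⟨fun p => b p + c p, fun p => add_nonneg (hb p) (hc p), fun x y => ?_⟩
  convert! (hF x y).add (hG x y) using 2
  ring

/-- Repeated use of `2 cos A cos B = cos(A + B) + cos(A - B)` leads to a positive combination of
pure cosines, each averaging to `0` or `1`. The induction needs an arbitrary `h'`, since every step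
shifts it by `± h i`. -/
theorem qmcRule_cos_mul_prod_nonneg {s N : ℕ} (hN : N ≠ 0) (z : Fin s → ℕ) (h : Fin s → ℤ)
    (t : Finset (Fin s)) : ∀ h' : Fin s → ℤ,
    0 ≤ qmcRule (latticePoints N z) fun x =>
      Real.cos (2 * Real.pi * ∑ j, (h' j : ℝ) * (x j : ℝ)) * ∏ j ∈ t, cosFun (h j) (x j) := by
  induction t using Finset.induction_on with
  | empty =>
    intro h'
    simp only [Finset.prod_empty, mul_one, qmcRule_cos hN]
    split_ifs <;> simp
  | insert i t hi ih =>
    intro h'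
    obtain ⟨d, hd⟩ : ∃ d : Fin s → ℤ, d = Pi.single i (h i) := ⟨_, rfl⟩
    have key : ∀ x : Cube s, Real.cos (2 * Real.pi * ∑ j, (h' j : ℝ) * (x j : ℝ)) *
        cosFun (h i) (x i) =
        2⁻¹ * (Real.cos (2 * Real.pi * ∑ j, (((h' + d) j : ℤ) : ℝ) * (x j : ℝ)) +
        Real.cos (2 * Real.pi * ∑ j, (((h' - d) j : ℤ) : ℝ) * (x j : ℝ))) := by
      intro x
      have e : ∑ j, (d j : ℝ) * (x j : ℝ) = h i * x i := by
        rw [hd, Finset.sum_eq_single i]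
        · simp
        · intro j _ hj
          simp [hj]
        · simp
      simp only [Pi.add_apply, Pi.sub_apply, Int.cast_add, Int.cast_sub, add_mul, sub_mul,
        Finset.sum_add_distrib, Finset.sum_sub_distrib, e, cosFun, mul_add, mul_sub, Real.cos_add,
        Real.cos_sub]
      ring
    have : (fun x : Cube s => Real.cos (2 * Real.pi * ∑ j, (h' j : ℝ) * (x j : ℝ)) *
        ∏ j ∈ insert i t, cosFun (h j) (x j)) = fun x =>
        2⁻¹ * (Real.cos (2 * Real.pi * ∑ j, (((h' + d) j : ℤ) : ℝ) * (x j : ℝ)) *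
          ∏ j ∈ t, cosFun (h j) (x j) +
        Real.cos (2 * Real.pi * ∑ j, (((h' - d) j : ℤ) : ℝ) * (x j : ℝ)) *
          ∏ j ∈ t, cosFun (h j) (x j)) := by
      ext x
      rw [Finset.prod_insert hi, ← mul_assoc, key]
      ring
    rw [this, qmcRule_mul_left, qmcRule_add]
    exact mul_nonneg (by norm_num) (add_nonneg (ih _) (ih _))

theorem qmcRule_prod_cosFun_nonneg {s N : ℕ} (hN : N ≠ 0) (z : Fin s → ℕ) (h : Fin s → ℤ) :
    0 ≤ qmcRule (latticePoints N z) fun x => ∏ j, cosFun (h j) (x j) := by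
  simpa using qmcRule_cos_mul_prod_nonneg hN z h Finset.univ 0

/-- The average of a kernel over all the pairs of points of `P`. -/
def pairAverage {X : Type*} (P : Multiset X) (F : X → X → ℝ) : ℝ :=
  qmcRule P fun x => qmcRule P fun y => F x y

theorem pairAverage_mul {X : Type*} (P : Multiset X) (f g : X → ℝ) :
    pairAverage P (fun x y => f x * g y) = qmcRule P f * qmcRule P g := by
  simp_rw [pairAverage, qmcRule_mul_left, qmcRule_mul_right]

/-- The cosine series are expanded one coordinate at a time, `t` being the set of coordinates not
yet expanded. Once `t` is empty, the pair average splits into two nonnegative averages of products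
of cosines. -/
theorem pairAverage_prod_nonneg_of_subset {s N : ℕ} (hN : N ≠ 0) (z : Fin s → ℕ)
    (t : Finset (Fin s)) : ∀ F : Fin s → I → I → ℝ, (∀ j ∈ t, IsCosPositive (F j)) →
      (∀ j ∉ t, ∃ h m, F j = fun x y => cosFun h x * cosFun m y) →
      0 ≤ pairAverage (latticePoints N z) fun x y => ∏ j, F j (x j) (y j) := by
  induction t using Finset.induction_on with
  | empty =>
    intro F _ hF
    choose h m hhm using fun j => hF j (Finset.notMem_empty j)
    simp only [hhm, Finset.prod_mul_distrib]
    rw [pairAverage_mul]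
    exact mul_nonneg (qmcRule_prod_cosFun_nonneg hN z h) (qmcRule_prod_cosFun_nonneg hN z m)
  | insert i t hi ih =>
    intro F hF hF'
    obtain ⟨b, hb, hFi⟩ := hF i (Finset.mem_insert_self i t)
    let G : ℤ × ℤ → Fin s → I → I → ℝ := fun p =>
      Function.update F i fun x y => cosFun p.1 x * cosFun p.2 y
    have hG : ∀ p (x y : Cube s), ∏ j, G p j (x j) (y j) =
        (cosFun p.1 (x i) * cosFun p.2 (y i)) * ∏ j ∈ Finset.univ.erase i, F j (x j) (y j) := by
      intro p x y
      rw [← Finset.mul_prod_erase _ _ (Finset.mem_univ i)]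
      congr 1
      · simp [G]
      · refine Finset.prod_congr rfl fun j hj => ?_
        simp [G, Finset.ne_of_mem_erase hj]
    have hs : HasSum (fun p : ℤ × ℤ => b p * pairAverage (latticePoints N z)
        fun x y => ∏ j, G p j (x j) (y j))
        (pairAverage (latticePoints N z) fun x y => ∏ j, F j (x j) (y j)) := by
      simp only [pairAverage, ← qmcRule_mul_left]
      refine hasSum_qmcRule _ fun x => hasSum_qmcRule _ fun y => ?_
      rw [← Finset.mul_prod_erase _ _ (Finset.mem_univ i)]
      simp only [hG, ← mul_assoc]
      refine HasSum.mul_right _ ?_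
      simpa only [mul_assoc] using hFi (x i) (y i)
    refine hs.nonneg fun p => mul_nonneg (hb p) (ih _ (fun j hj => ?_) fun j hj => ?_)
    · have : j ≠ i := fun h => hi (h ▸ hj)
      simp only [G, Function.update_of_ne this]
      exact hF j (Finset.mem_insert_of_mem hj)
    · by_cases hji : j = i
      · subst hji
        exact ⟨p.1, p.2, by simp [G]⟩
      · simp only [G, Function.update_of_ne hji]
        exact hF' j (by simp [hji, hj])

theorem pairAverage_prod_nonneg {s N : ℕ} (hN : N ≠ 0) (z : Fin s → ℕ)
    {F : Fin s → I → I → ℝ} (hF : ∀ j, IsCosPositive (F j)) :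
    0 ≤ pairAverage (latticePoints N z) fun x y => ∏ j, F j (x j) (y j) :=
  pairAverage_prod_nonneg_of_subset hN z Finset.univ F (fun j _ => hF j) fun j hj =>
    absurd (Finset.mem_univ j) hj

/-- Telescoping: replacing a single factor `F i` by `G i` changes the product by one with the factor
`G i - F i`, all of whose factors are again cosine positive. -/
theorem pairAverage_prod_mono {s N : ℕ} (hN : N ≠ 0) (z : Fin s → ℕ)
    {F G : Fin s → I → I → ℝ} (hF : ∀ j, IsCosPositive (F j))
    (hFG : ∀ j, IsCosPositive fun x y => G j x y - F j x y) :
    (pairAverage (latticePoints N z) fun x y => ∏ j, F j (x j) (y j)) ≤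
      pairAverage (latticePoints N z) fun x y => ∏ j, G j (x j) (y j) := by
  have hG : ∀ j, IsCosPositive (G j) := fun j => by
    simpa using (hF j).add (hFG j)
  have key : ∀ t : Finset (Fin s),
      (pairAverage (latticePoints N z) fun x y => ∏ j, F j (x j) (y j)) ≤
        pairAverage (latticePoints N z) fun x y =>
          ∏ j, (if j ∈ t then G j else F j) (x j) (y j) := by
    intro t
    induction t using Finset.induction_on with
    | empty => simp
    | insert i t hi ih =>
      refine ih.trans ?_
      rw [← sub_nonneg]
      have := pairAverage_prod_nonneg hN z (F := fun j => if j = i then fun x y => G i x y - F i x y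
        else if j ∈ t then G j else F j) fun j => by
          by_cases hj : j = i
          · simpa [hj] using hFG i
          · by_cases hjt : j ∈ t <;> simp [hj, hjt, hF, hG]
      refine this.trans_eq ?_
      simp only [pairAverage, ← qmcRule_sub]
      congr 1 with x
      congr 1 with y
      rw [← Finset.mul_prod_erase _ _ (Finset.mem_univ i),
        ← Finset.mul_prod_erase _ (fun j => (if j ∈ insert i t then G j else F j) (x j) (y j))
          (Finset.mem_univ i),
        ← Finset.mul_prod_erase _ (fun j => (if j ∈ t then G j else F j) (x j) (y j))
          (Finset.mem_univ i)]
      rw [Finset.prod_congr (g := fun j => (if j ∈ t then G j else F j) (x j) (y j)) rfl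
          fun j hj => by rw [if_neg (Finset.ne_of_mem_erase hj)],
        Finset.prod_congr (f := fun j => (if j ∈ insert i t then G j else F j) (x j) (y j))
          (g := fun j => (if j ∈ t then G j else F j) (x j) (y j)) rfl
          fun j hj => by simp [Finset.ne_of_mem_erase hj]]
      simp only [if_true, Finset.mem_insert_self, if_neg hi]
      ring
  simpa using key Finset.univ

theorem pairAverage_prod_mono_finset {s N : ℕ} (hN : N ≠ 0) (z : Fin s → ℕ) (u : Finset (Fin s))
    {F G : I → I → ℝ} (hF : IsCosPositive F) (hFG : IsCosPositive fun x y => G x y - F x y) :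
    (pairAverage (latticePoints N z) fun x y => ∏ j ∈ u, F (x j) (y j)) ≤
      pairAverage (latticePoints N z) fun x y => ∏ j ∈ u, G (x j) (y j) := by
  have h0 : IsCosPositive fun _ _ => 0 := ⟨0, fun _ => le_rfl, fun x y => by simp⟩
  have := pairAverage_prod_mono hN z (F := fun j => if j ∈ u then F else fun _ _ => 1)
    (G := fun j => if j ∈ u then G else fun _ _ => 1)
    (fun j => by by_cases hj : j ∈ u <;> simp [hj, hF, isCosPositive_one])
    (fun j => by by_cases hj : j ∈ u <;> simp [hj, hFG, h0])
  have e : ∀ (H : I → I → ℝ) (x y : Cube s),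
      ∏ j, (if j ∈ u then H else fun _ _ => 1) (x j) (y j) = ∏ j ∈ u, H (x j) (y j) := by
    intro H x y
    rw [← Finset.univ_inter u, ← Finset.prod_ite_mem, Finset.univ_inter]
    refine Finset.prod_congr rfl fun j _ => ?_
    split_ifs <;> rfl
  simpa only [e] using this

/-! ### Symmetrization -/

theorem qmcRule_symmetrize {s : ℕ} (P : Multiset (Cube s)) (f : Cube s → ℝ) :
    qmcRule (symmetrize P) f = qmcRule P fun x => (2 ^ s : ℝ)⁻¹ * ∑ v, f (reflect v x) := by
  have h1 : ((symmetrize P).map f).sum = ∑ v, (P.map fun x => f (reflect v x)).sum := by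
    rw [symmetrize, Multiset.map_bind, Multiset.sum_bind]
    simp only [Multiset.map_map]
    rfl
  have h2 : Multiset.card (symmetrize P) = 2 ^ s * Multiset.card P := by
    simp [symmetrize, Multiset.card_bind, Multiset.map_const', Multiset.sum_replicate]
  rw [qmcRule_mul_left, qmcRule_sum]
  simp only [qmcRule]
  rw [h1, h2, ← Finset.sum_div]
  push_cast
  rw [div_mul_eq_div_div, inv_mul_eq_div, div_right_comm]

/-- Expand the product over all coordinates of half-sums; coordinates outside `u` contribute `1/2 +
1/2 = 1`. -/
theorem sum_prod_ite_mem {s : ℕ} (u : Finset (Fin s)) (f g : Fin s → ℝ) :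
    (2 ^ s : ℝ)⁻¹ * ∑ v : Finset (Fin s), ∏ j ∈ u, (if j ∈ v then g j else f j) =
      ∏ j ∈ u, ((g j + f j) / 2) := by
  have e : ∀ F : Fin s → ℝ, ∏ j ∈ u, F j = ∏ j, if j ∈ u then F j else 1 := fun F => by
    rw [Finset.prod_ite_mem, Finset.univ_inter]
  have h : ∏ j ∈ u, ((g j + f j) / 2) =
      ∏ j, ((if j ∈ u then g j else 1) / 2 + (if j ∈ u then f j else 1) / 2) := by
    rw [e]
    refine Finset.prod_congr rfl fun j _ => ?_
    split_ifs <;> ring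
  rw [h, Finset.prod_add, Finset.powerset_univ, Finset.mul_sum]
  refine Finset.sum_congr rfl fun v _ => ?_
  simp only [Finset.prod_div_distrib, Finset.prod_const]
  rw [div_mul_div_comm, ← pow_add, Finset.card_sdiff_of_subset (Finset.subset_univ v),
    Nat.add_sub_cancel' (Finset.card_le_card (Finset.subset_univ v)), Finset.card_univ,
    Fintype.card_fin, inv_mul_eq_div]
  congr 1
  rw [e, ← Finset.compl_eq_univ_sdiff, ← Finset.prod_mul_prod_compl v]
  congr 1
  · refine Finset.prod_congr rfl fun j hj => ?_
    simp [hj]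
  · refine Finset.prod_congr rfl fun j hj => ?_
    simp [Finset.mem_compl.mp hj]

/-- The average of a kernel in one variable over the reflections of both variables. -/
def reflectAverage (k : Matrix I I ℝ) (x y : I) : ℝ :=
  (k (σ x) (σ y) + k (σ x) y + k x (σ y) + k x y) / 4

theorem pairAverage_symmetrize {s : ℕ} (P : Multiset (Cube s)) (k : Matrix I I ℝ)
    (u : Finset (Fin s)) :
    pairAverage (symmetrize P) (fun x y => ∏ j ∈ u, k (x j) (y j)) =
      pairAverage P fun x y => ∏ j ∈ u, reflectAverage k (x j) (y j) := by
  have h1 : ∀ (f : Fin s → I → ℝ),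
      qmcRule (symmetrize P) (fun y => ∏ j ∈ u, f j (y j)) =
        qmcRule P fun y => ∏ j ∈ u, ((f j (σ (y j)) + f j (y j)) / 2) := by
    intro f
    rw [qmcRule_symmetrize]
    congr 1 with y
    rw [← sum_prod_ite_mem]
    congr 1
    refine Finset.sum_congr rfl fun v _ => Finset.prod_congr rfl fun j _ => ?_
    rw [reflect]
    split_ifs <;> rfl
  -- `h1` treats the inner variable only; interchanging the averages makes it applicable to the
  -- other one.
  have comm : ∀ (Q R : Multiset (Cube s)) (F : Cube s → Cube s → ℝ),
      qmcRule Q (fun x => qmcRule R fun y => F x y) =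
        qmcRule R fun y => qmcRule Q fun x => F x y := by
    intro Q R F
    simp only [qmcRule, Multiset.sum_map_div]
    rw [Multiset.sum_map_sum_map, div_right_comm]
  simp only [pairAverage]
  simp_rw [fun x : Cube s => h1 fun j => k (x j)]
  rw [comm]
  simp_rw [fun y : Cube s => h1 fun j x => (k x (σ (y j)) + k x (y j)) / 2]
  rw [comm]
  congr 1 with x
  congr 1 with y
  refine Finset.prod_congr rfl fun j _ => ?_
  rw [reflectAverage]
  ring

/-! ### The symmetrized Sobolev kernel in one variable -/

theorem bernoulliFun_symm (n : ℕ) (x : I) :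
    bernoulliFun n (σ x : I) = (-1) ^ n * bernoulliFun n (x : ℝ) := by
  rw [unitInterval.coe_symm_eq, bernoulliFun_eval_one_sub]

/-- Under `x ↦ 1 - x` odd Bernoulli polynomials change sign and cancel, whereas `B_a` is invariant.
The signs in the two copies of `b_a` multiply to `1`, and both `b_a(x) b_a(y)` and `b_{2a}` carry
the normalization `(2π)^{2a}`. -/
theorem reflectAverage_sobOddKernelOne {a : ℕ} (ha : a ≠ 0) (he : Even a) (x y : I) :
    reflectAverage (sobOddKernelOne a) x y =
      ((2 * Real.pi) ^ (2 * a))⁻¹ * (bernoulliSeries a x * bernoulliSeries a y +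
        reflectAverage (korobovKernelOne (2 * a)) x y) := by
  have hp : ((2 * Real.pi) ^ (2 * a) : ℝ) ≠ 0 := by positivity
  have hsum : ∀ x y : I, (∑ τ ∈ Finset.Icc 1 a with (Odd τ ∨ τ = a),
      bernoulliFun τ x * bernoulliFun τ y / (τ.factorial : ℝ) ^ 2) =
      (∑ τ ∈ Finset.Icc 1 a with Odd τ,
        bernoulliFun τ x * bernoulliFun τ y / (τ.factorial : ℝ) ^ 2) +
      bernoulliFun a x * bernoulliFun a y / (a.factorial : ℝ) ^ 2 := by
    intro x y
    have : (Finset.Icc 1 a).filter (fun τ => Odd τ ∨ τ = a) =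
        insert a ((Finset.Icc 1 a).filter Odd) := by
      ext τ
      simp only [Finset.mem_filter, Finset.mem_Icc, Finset.mem_insert]
      constructor
      · rintro ⟨h, h' | h'⟩
        · exact Or.inr ⟨h, h'⟩
        · exact Or.inl h'
      · rintro (rfl | h)
        · exact ⟨by omega, Or.inr rfl⟩
        · exact ⟨h.1, Or.inl h.2⟩
    rw [this, Finset.sum_insert, add_comm]
    simp [he]
  have hodd : ∀ x y : I, (∑ τ ∈ Finset.Icc 1 a with Odd τ,
      bernoulliFun τ (σ x : I) * bernoulliFun τ y / (τ.factorial : ℝ) ^ 2) =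
      -∑ τ ∈ Finset.Icc 1 a with Odd τ,
        bernoulliFun τ x * bernoulliFun τ y / (τ.factorial : ℝ) ^ 2 := by
    intro x y
    rw [← Finset.sum_neg_distrib]
    refine Finset.sum_congr rfl fun τ hτ => ?_
    rw [bernoulliFun_symm, (Finset.mem_filter.mp hτ).2.neg_one_pow]
    ring
  have hser : ∀ t, (-1) ^ (a + 1) * bernoulliFun (2 * a) t / ((2 * a).factorial : ℝ) =
      ((2 * Real.pi) ^ (2 * a))⁻¹ * bernoulliSeries (2 * a) t := by
    intro t
    rw [bernoulliSeries, Nat.mul_div_cancel_left _ two_pos]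
    field_simp
  have hprod : bernoulliFun a x * bernoulliFun a y / (a.factorial : ℝ) ^ 2 =
      ((2 * Real.pi) ^ (2 * a))⁻¹ * (bernoulliSeries a x * bernoulliSeries a y) := by
    have h1 : ((-1 : ℝ) ^ (a / 2 + 1)) * (-1) ^ (a / 2 + 1) = 1 := by
      rw [← mul_pow]
      norm_num
    have h2 : ((2 * Real.pi) ^ (2 * a))⁻¹ * (bernoulliSeries a x * bernoulliSeries a y) =
        (((-1 : ℝ) ^ (a / 2 + 1)) * (-1) ^ (a / 2 + 1)) *
          (((2 * Real.pi) ^ (2 * a))⁻¹ * (2 * Real.pi) ^ (2 * a)) *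
          (bernoulliFun a x * bernoulliFun a y / (a.factorial : ℝ) ^ 2) := by
      rw [bernoulliSeries, bernoulliSeries, two_mul a, pow_add]
      ring
    rw [h2, h1, inv_mul_cancel₀ hp]
    ring
  simp only [reflectAverage, sobOddKernelOne, korobovKernelOne, Matrix.of_apply, hsum, hodd,
    hser]
  rw [bernoulliFun_symm, bernoulliFun_symm, he.neg_one_pow]
  simp only [one_mul, hprod]
  ring

theorem hasSum_bernoulliSeries {a : ℕ} (ha : 2 ≤ a) (he : Even a) {t : ℝ} (ht : |t| ≤ 1) :
    HasSum (fun h : ℤ => decay a h * Real.cos (2 * Real.pi * (h * t)))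
      (bernoulliSeries a |t|) := by
  have := Complex.hasSum_re (hasSum_decay_abs ha he ht)
  rw [Complex.ofReal_re] at this
  simpa only [Complex.re_ofReal_mul, cexp_re] using this

theorem hasSum_bernoulliSeries_cosFun {a : ℕ} (ha : 2 ≤ a) (he : Even a) (x : I) :
    HasSum (fun h : ℤ => decay a h * cosFun h x) (bernoulliSeries a x) := by
  have := hasSum_bernoulliSeries ha he (t := x) (by rw [abs_of_nonneg x.2.1]; exact x.2.2)
  rwa [abs_of_nonneg x.2.1] at this

theorem abs_cosFun_le_one (h : ℤ) (x : I) : |cosFun h x| ≤ 1 := Real.abs_cos_le_one _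

theorem hasSum_bernoulliSeries_mul {a : ℕ} (ha : 2 ≤ a) (he : Even a) (x y : I) :
    HasSum (fun p : ℤ × ℤ => decay a p.1 * decay a p.2 * (cosFun p.1 x * cosFun p.2 y))
      (bernoulliSeries a x * bernoulliSeries a y) := by
  have hn : ∀ x, Summable fun h : ℤ => ‖decay a h * cosFun h x‖ := fun x =>
    Summable.of_nonneg_of_le (fun _ => norm_nonneg _) (fun h => by
      rw [norm_mul, Real.norm_of_nonneg (decay_nonneg a h)]
      exact mul_le_of_le_one_right (decay_nonneg a h) (abs_cosFun_le_one h x)) (summable_decay ha)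
  have := HasSum.mul (f := fun h : ℤ => decay a h * cosFun h x)
    (g := fun h : ℤ => decay a h * cosFun h y) (hasSum_bernoulliSeries_cosFun ha he x)
    (hasSum_bernoulliSeries_cosFun ha he y) (summable_mul_of_summable_norm
      (f := fun h : ℤ => decay a h * cosFun h x) (g := fun h : ℤ => decay a h * cosFun h y)
      (hn x) (hn y))
  convert! this using 2
  ring

/-- Up to integer periods, the reflections turn `cos 2πh(x - y)` into `cos 2πh(x ± y)`, each sign
twice; the sine products cancel in the mean. -/
theorem hasSum_reflectAverage_korobovKernelOne {a : ℕ} (ha : 2 ≤ a) (he : Even a) (x y : I) :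
    HasSum (fun h : ℤ => decay a h * (cosFun h x * cosFun h y))
      (reflectAverage (korobovKernelOne a) x y) := by
  have h := fun x y : I => hasSum_bernoulliSeries ha he (abs_sub_le_one x y)
  have := ((((h (σ x) (σ y)).add (h (σ x) y)).add (h x (σ y))).add (h x y)).div_const 4
  convert! this using 2 with n
  have c1 : Real.cos (2 * Real.pi * (n * (1 - x - (1 - y : ℝ)))) =
      Real.cos (2 * Real.pi * (n * (x : ℝ)) - 2 * Real.pi * (n * (y : ℝ))) := by
    rw [← Real.cos_neg]
    congr 1
    ring
  have c2 : Real.cos (2 * Real.pi * (n * (1 - x - (y : ℝ)))) =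
      Real.cos (2 * Real.pi * (n * (x : ℝ)) + 2 * Real.pi * (n * (y : ℝ))) := by
    rw [← Real.cos_neg, ← Real.cos_add_int_mul_two_pi _ n]
    congr 1
    ring
  have c3 : Real.cos (2 * Real.pi * (n * (x - (1 - y : ℝ)))) =
      Real.cos (2 * Real.pi * (n * (x : ℝ)) + 2 * Real.pi * (n * (y : ℝ))) := by
    rw [← Real.cos_add_int_mul_two_pi _ n]
    congr 1
    ring
  have c4 : Real.cos (2 * Real.pi * (n * (x - (y : ℝ)))) =
      Real.cos (2 * Real.pi * (n * (x : ℝ)) - 2 * Real.pi * (n * (y : ℝ))) := by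
    congr 1
    ring
  rw [unitInterval.coe_symm_eq, unitInterval.coe_symm_eq, c1, c2, c3, c4, Real.cos_add,
    Real.cos_sub, cosFun, cosFun]
  ring

/-- Since `|h|^{-2a} = |h|^{-a} |h|^{-a}`, the single series becomes a double series on the
diagonal, with the coefficients of `b_a(x) b_a(y)` there. -/
theorem hasSum_diagonal {a : ℕ} (he : Even a) (x y : I) {S : ℝ} (hS : HasSum
    (fun h : ℤ => decay (2 * a) h * (cosFun h x * cosFun h y)) S) :
    HasSum (fun p : ℤ × ℤ => (if p.1 = p.2 then decay a p.1 * decay a p.2 else 0) *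
      (cosFun p.1 x * cosFun p.2 y)) S := by
  have hinj : Function.Injective fun h : ℤ => (h, h) := fun h h' e => (Prod.ext_iff.mp e).1
  rw [← hinj.hasSum_iff]
  · convert! hS using 2 with h
    simp only [Function.comp_apply, if_true]
    rw [decay_eq_of_even he, decay_eq_of_even (even_two_mul a), two_mul, pow_add]
    field_simp
  · intro p hp
    have : p.1 ≠ p.2 := fun e => hp ⟨p.1, by ext <;> simp [e]⟩
    simp [this]

theorem hasSum_antidiagonal {a : ℕ} (he : Even a) (x y : I) {S : ℝ} (hS : HasSum
    (fun h : ℤ => decay (2 * a) h * (cosFun h x * cosFun h y)) S) :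
    HasSum (fun p : ℤ × ℤ => (if p.1 = -p.2 then decay a p.1 * decay a p.2 else 0) *
      (cosFun p.1 x * cosFun p.2 y)) S := by
  rw [← ((Equiv.refl ℤ).prodCongr (Equiv.neg ℤ)).hasSum_iff]
  convert! hasSum_diagonal he x y hS using 2 with p
  simp [decay_neg, cosFun_neg]

/-- As cosine is even, the diagonal and antidiagonal series have the same sum, and their mean is
used. It puts the factor `1/2` instead of `1` on each occupied pair, so the comparison constant is
`3/2` rather than `2`. -/
theorem hasSum_reflectAverage_sobOddKernelOne {a : ℕ} (ha : 2 ≤ a) (he : Even a) (x y : I) :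
    HasSum (fun p : ℤ × ℤ => ((2 * Real.pi) ^ (2 * a))⁻¹ * (decay a p.1 * decay a p.2 +
      ((if p.1 = p.2 then decay a p.1 * decay a p.2 else 0) +
        (if p.1 = -p.2 then decay a p.1 * decay a p.2 else 0)) / 2) *
          (cosFun p.1 x * cosFun p.2 y)) (reflectAverage (sobOddKernelOne a) x y) := by
  rw [reflectAverage_sobOddKernelOne (by omega) he]
  have hS := hasSum_reflectAverage_korobovKernelOne (a := 2 * a) (by omega) (even_two_mul a) x y
  have := ((hasSum_bernoulliSeries_mul ha he x y).add
    (((hasSum_diagonal he x y hS).add (hasSum_antidiagonal he x y hS)).div_const 2)).mul_left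
      ((2 * Real.pi) ^ (2 * a))⁻¹
  rw [add_self_div_two] at this
  convert! this using 2 with p
  ring

theorem isCosPositive_reflectAverage {a : ℕ} (ha : 2 ≤ a) (he : Even a) :
    IsCosPositive (reflectAverage (sobOddKernelOne a)) := by
  refine ⟨_, fun p => ?_, hasSum_reflectAverage_sobOddKernelOne ha he⟩
  have := mul_nonneg (decay_nonneg a p.1) (decay_nonneg a p.2)
  split_ifs <;> positivity

theorem isCosPositive_sub_reflectAverage {a : ℕ} (ha : 2 ≤ a) (he : Even a) :
    IsCosPositive fun x y => 3 / 2 * ((2 * Real.pi) ^ (2 * a))⁻¹ *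
      (bernoulliSeries a x * bernoulliSeries a y) - reflectAverage (sobOddKernelOne a) x y := by
  refine ⟨fun p => ((2 * Real.pi) ^ (2 * a))⁻¹ * (decay a p.1 * decay a p.2 / 2 -
      ((if p.1 = p.2 then decay a p.1 * decay a p.2 else 0) +
        (if p.1 = -p.2 then decay a p.1 * decay a p.2 else 0)) / 2), fun p => ?_, fun x y => ?_⟩
  · refine mul_nonneg (by positivity) ?_
    have := mul_nonneg (decay_nonneg a p.1) (decay_nonneg a p.2)
    -- The diagonals meet only at `(0, 0)`, where `decay` vanishes; elsewhere at most one half is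
    -- subtracted from one half.
    split_ifs with h1 h2
    · have : p.1 = 0 := by omega
      rw [this, decay_zero (by omega)]
      simp
    all_goals linarith
  · convert! ((hasSum_bernoulliSeries_mul ha he x y).mul_left
      (3 / 2 * ((2 * Real.pi) ^ (2 * a))⁻¹)).sub
        (hasSum_reflectAverage_sobOddKernelOne ha he x y) using 2 with p
    ring

/-! ### The worst-case error of symmetrized lattice rules -/

theorem sq_modifiedWeights {s : ℕ} (a : ℕ) (γ : Finset (Fin s) → ℝ≥0) (u : Finset (Fin s)) :
    (modifiedWeights a γ u : ℝ) ^ 2 =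
      γ u * (3 / 2 * ((2 * Real.pi) ^ (2 * a))⁻¹) ^ u.card := by
  rw [← NNReal.coe_pow, modifiedWeights, NNReal.sq_sqrt]
  push_cast
  rw [mul_pow 2 Real.pi, pow_succ, NNReal.coe_real_pi]
  congr 2
  field_simp

theorem pairAverage_reflectAverage_le {s N a : ℕ} (ha : 2 ≤ a) (he : Even a) (hN : N ≠ 0)
    (z : Fin s → ℕ) (u : Finset (Fin s)) :
    (pairAverage (latticePoints N z) fun x y =>
      ∏ j ∈ u, reflectAverage (sobOddKernelOne a) (x j) (y j)) ≤
      (3 / 2 * ((2 * Real.pi) ^ (2 * a))⁻¹) ^ u.card * seriesAverage a N z u ^ 2 := by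
  refine (pairAverage_prod_mono_finset hN z u (isCosPositive_reflectAverage ha he)
    (isCosPositive_sub_reflectAverage ha he)).trans_eq ?_
  simp_rw [Finset.prod_mul_distrib, Finset.prod_const, ← mul_pow]
  rw [sq, seriesAverage, ← pairAverage_mul]
  simp only [pairAverage, qmcRule_mul_left]

theorem symmetrize_ne_zero {s : ℕ} {P : Multiset (Cube s)} (hP : P ≠ 0) : symmetrize P ≠ 0 := by
  obtain ⟨x, hx⟩ := Multiset.exists_mem_of_ne_zero hP
  intro h
  have : reflect ∅ x ∈ symmetrize P := by
    rw [symmetrize, Multiset.mem_bind]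
    exact ⟨∅, Finset.mem_univ_val _, Multiset.mem_map_of_mem _ hx⟩
  simp [h] at this

theorem worstCaseError_sobOdd_le {s N a : ℕ} [NeZero a] (ha : 2 ≤ a) (he : Even a) (hN : N ≠ 0)
    (γ : Finset (Fin s) → ℝ≥0) (z : Fin s → ℕ) :
    worstCaseError (SobOddSpace a γ) (symmetrize (latticePoints N z)) ≤
      worstCaseError (KorobovSpace ((a : ℝ) / 2) (modifiedWeights a γ)) (latticePoints N z) ^ 2 := by
  have hP := symmetrize_ne_zero (latticePoints_ne_zero hN z)
  rw [← ENNReal.pow_le_pow_left_iff two_ne_zero, worstCaseError_korobov_sq_eq_ofReal ha he hN,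
    worstCaseError_sq (sobOddKernel a γ) (continuous_prodKernel γ (continuous_sobOddKernelOne a))
      (integral_prodKernel γ (continuous_sobOddKernelOne a) (integral_sobOddKernelOne (by omega)))
      hP]
  have hnn : ∀ u ∈ (Finset.univ : Finset (Finset (Fin s))).erase ∅,
      0 ≤ (modifiedWeights a γ u : ℝ) * seriesAverage a N z u := fun u hu =>
    mul_nonneg NNReal.zero_le_coe (seriesAverage_nonneg ha he hN z (Finset.ne_of_mem_erase hu))
  rw [← ENNReal.ofReal_pow (Finset.sum_nonneg hnn)]
  refine ENNReal.ofReal_le_ofReal ?_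
  simp only [sobOddKernel, Matrix.of_apply, qmcRule_add, qmcRule_const hP, qmcRule_sum,
    qmcRule_mul_left, add_sub_cancel_left]
  -- The weights `w_u` satisfy `w_u² = γ_u c^{|u|}` with `c` the comparison constant, so each term
  -- is at most `(w_u S_u)²`; the sum of squares of nonnegative numbers is at most the square of
  -- their sum.
  refine le_trans (Finset.sum_le_sum fun u hu => ?_) (Finset.sum_sq_le_sq_sum_of_nonneg hnn)
  have h1 := pairAverage_symmetrize (latticePoints N z) (sobOddKernelOne a) u
  have h2 := pairAverage_reflectAverage_le ha he hN z u
  rw [← h1] at h2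
  rw [mul_pow, sq_modifiedWeights, mul_assoc]
  exact mul_le_mul_of_nonneg_left h2 NNReal.zero_le_coe

/-! ### Jensen's inequality for sums in `[0, ∞]` -/

theorem ennreal_sum_rpow_le {ι : Type*} (t : Finset ι) (f : ι → ℝ≥0∞) {l : ℝ} (hl : 0 < l)
    (hl1 : l ≤ 1) : (∑ i ∈ t, f i) ^ l ≤ ∑ i ∈ t, f i ^ l := by
  classical
  induction t using Finset.induction_on with
  | empty => simp [hl]
  | insert i t hi ih =>
    rw [Finset.sum_insert hi, Finset.sum_insert hi]
    exact (ENNReal.rpow_add_le_add_rpow _ _ hl.le hl1).trans (add_le_add le_rfl ih)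

theorem ennreal_tsum_rpow_le {ι : Type*} (f : ι → ℝ≥0∞) {l : ℝ} (hl : 0 < l) (hl1 : l ≤ 1) :
    (∑' i, f i) ^ l ≤ ∑' i, f i ^ l := by
  rw [← ENNReal.le_rpow_inv_iff hl, ENNReal.tsum_eq_iSup_sum]
  refine iSup_le fun t => ?_
  rw [ENNReal.le_rpow_inv_iff hl]
  exact (ennreal_sum_rpow_le t f hl hl1).trans (ENNReal.sum_le_tsum t)

/-! ### Counting solutions of linear congruences -/

/-- A solution forces `N ∤ k`, since otherwise `N ∣ m`. Then `c` is determined modulo `N`, and the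
range is shorter than `N`. -/
theorem card_congruence_le_one {N : ℕ} (hN : N.Prime) {m : ℤ} (hm : ¬ (N : ℤ) ∣ m) (k : ℤ) :
    ((Finset.Icc 1 (N - 1)).filter fun c : ℕ => (N : ℤ) ∣ m + k * c).card ≤ 1 := by
  have hp : Prime (N : ℤ) := Nat.prime_iff_prime_int.mp hN
  rw [Finset.card_le_one]
  intro c hc c' hc'
  simp only [Finset.mem_filter, Finset.mem_Icc] at hc hc'
  have h1 : (N : ℤ) ∣ k * ((c : ℤ) - c') := by
    have e : k * ((c : ℤ) - c') = (m + k * c) - (m + k * c') := by ring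
    exact e ▸ dvd_sub hc.2 hc'.2
  rcases hp.dvd_or_dvd h1 with h | h
  · exact absurd ((Int.dvd_add_left (h.mul_right _)).mp hc.2) hm
  · have h2 : (c : ℤ) - c' = 0 := by
      refine Int.eq_zero_of_abs_lt_dvd h ?_
      rw [abs_lt]
      have := hN.two_le
      omega
    omega

theorem card_congruence_of_not_dvd {N : ℕ} (hN : N.Prime) {m k : ℤ} (hm : (N : ℤ) ∣ m)
    (hk : ¬ (N : ℤ) ∣ k) :
    ((Finset.Icc 1 (N - 1)).filter fun c : ℕ => (N : ℤ) ∣ m + k * c).card = 0 := by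
  have hp : Prime (N : ℤ) := Nat.prime_iff_prime_int.mp hN
  rw [Finset.card_eq_zero, Finset.filter_eq_empty_iff]
  intro c hc h
  rw [Finset.mem_Icc] at hc
  rcases hp.dvd_or_dvd ((Int.dvd_add_right hm).mp h) with h | h
  · exact hk h
  · have := Nat.le_of_dvd (by omega) (Int.natCast_dvd_natCast.mp h)
    omega

/-- The power `|k|^{-al}` of the decay, as an extended nonnegative real number. -/
def decayPow (a : ℕ) (l : ℝ) (k : ℤ) : ℝ≥0∞ := ENNReal.ofReal (decay a k) ^ l

theorem decayPow_zero {a : ℕ} (ha : a ≠ 0) {l : ℝ} (hl : 0 < l) : decayPow a l 0 = 0 := by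
  simp [decayPow, decay_zero ha, hl]

theorem decayPow_mul_le {a N : ℕ} (hN : N ≠ 0) {l : ℝ} (hl : 0 < l) (hal : 1 < a * l) (j : ℤ) :
    decayPow a l (N * j) * N ≤ decayPow a l j := by
  have hN1 : (1 : ℝ) ≤ N := by exact_mod_cast Nat.one_le_iff_ne_zero.mpr hN
  have hN0 : (0 : ℝ) < N := by linarith
  have e : decay a (N * j) = (N : ℝ) ^ (-(a : ℝ)) * decay a j := by
    rw [decay, decay]
    push_cast
    rw [abs_mul, Real.mul_rpow (abs_nonneg _) (abs_nonneg _), abs_of_pos hN0]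
  have h1 : ENNReal.ofReal ((N : ℝ) ^ (-(a : ℝ))) ^ l * N ≤ 1 := by
    rw [ENNReal.ofReal_rpow_of_nonneg (by positivity) hl.le, ← Real.rpow_mul hN0.le,
      ← ENNReal.ofReal_natCast N, ← ENNReal.ofReal_mul (by positivity), ENNReal.ofReal_le_one]
    nth_rewrite 2 [← Real.rpow_one (N : ℝ)]
    rw [← Real.rpow_add hN0]
    exact Real.rpow_le_one_of_one_le_of_nonpos hN1 (by linarith)
  rw [decayPow, e, ENNReal.ofReal_mul (by positivity), ENNReal.mul_rpow_of_nonneg _ _ hl.le,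
    mul_right_comm]
  exact mul_le_of_le_one_left zero_le h1

/-- If `N ∤ m`, each `k` admits at most one `c`. If `N ∣ m`, only `k = N j` contributes, with at
most `N` values of `c`, and the rescaling gains `N^{-al} ≤ N^{-1}`. Either way no constant is lost.
-/
theorem tsum_decayPow_mul_card_le {a N : ℕ} (hN : N.Prime) {l : ℝ} (hl : 0 < l)
    (hal : 1 < a * l) (m : ℤ) :
    ∑' k : ℤ, decayPow a l k *
      ((Finset.Icc 1 (N - 1)).filter fun c : ℕ => (N : ℤ) ∣ m + k * c).card ≤
      ∑' k : ℤ, decayPow a l k := by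
  by_cases hm : (N : ℤ) ∣ m
  · have hinj : Function.Injective fun j : ℤ => (N : ℤ) * j :=
      mul_right_injective₀ (by exact_mod_cast hN.ne_zero)
    rw [← hinj.tsum_eq]
    · refine ENNReal.tsum_le_tsum fun j => ?_
      refine le_trans ?_ (decayPow_mul_le hN.ne_zero hl hal j)
      refine mul_le_mul_right ?_ _
      have : ((Finset.Icc 1 (N - 1)).filter fun c : ℕ => (N : ℤ) ∣ m + N * j * c).card ≤ N :=
        (Finset.card_filter_le _ _).trans (by simp)
      exact_mod_cast this
    · intro k hk
      by_contra hc
      have : ¬ (N : ℤ) ∣ k := fun ⟨j, hj⟩ => hc ⟨j, hj.symm⟩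
      rw [Function.mem_support, card_congruence_of_not_dvd hN hm this] at hk
      simp at hk
  · refine ENNReal.tsum_le_tsum fun k => ?_
    refine mul_le_of_le_one_right zero_le ?_
    exact_mod_cast card_congruence_le_one hN hm k

theorem ennreal_tsum_int_eq (f : ℤ → ℝ≥0∞) :
    ∑' k, f k = f 0 + ∑' k, if k = 0 then 0 else f k :=
  ENNReal.summable.tsum_eq_add_tsum_ite' 0

/-! ### Splitting off the last coordinate -/

theorem tsum_snoc {d : ℕ} (f : (Fin (d + 1) → ℤ) → ℝ≥0∞) :
    ∑' h, f h = ∑' k : ℤ, ∑' h : Fin d → ℤ, f (Fin.snoc (α := fun _ => ℤ) h k) := by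
  rw [← (Fin.snocEquiv fun _ => ℤ).tsum_eq, ENNReal.tsum_prod']
  rfl

theorem snoc_ne_zero {d : ℕ} (h : Fin d → ℤ) {k : ℤ} (hk : k ≠ 0) :
    (Fin.snoc (α := fun _ => ℤ) h k) ≠ 0 := by
  intro e
  have := congrFun e (Fin.last d)
  simp at this
  exact hk this

theorem snoc_zero_eq_zero_iff {d : ℕ} (h : Fin d → ℤ) :
    (Fin.snoc (α := fun _ => ℤ) h 0) = 0 ↔ h = 0 := by
  constructor
  · intro e
    ext j
    simpa using congrFun e j.castSucc
  · rintro rfl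
    ext j
    refine Fin.lastCases ?_ (fun j => ?_) j <;> simp

theorem inDual_snoc {d N : ℕ} (z : Fin d → ℕ) (c : ℕ) (h : Fin d → ℤ) (k : ℤ) :
    InDual N (Fin.snoc (α := fun _ => ℕ) z c) (Fin.snoc (α := fun _ => ℤ) h k) ↔
      (N : ℤ) ∣ (∑ j, h j * (z j : ℤ)) + k * c := by
  rw [InDual, Fin.sum_univ_castSucc]
  simp

/-- The Fourier weights in dimension `d ≤ s`, as extended nonnegative real numbers. -/
def dualWeight {s : ℕ} (a : ℕ) (w : Finset (Fin s) → ℝ≥0) {d : ℕ} (hd : d ≤ s)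
    (h : Fin d → ℤ) : ℝ≥0∞ :=
  ENNReal.ofReal (korobovWeight ((a : ℝ) / 2) (restrictWeights hd w) h)

theorem dualWeight_snoc_zero {s : ℕ} (a : ℕ) (w : Finset (Fin s) → ℝ≥0) {d : ℕ} (hd : d + 1 ≤ s)
    (h : Fin d → ℤ) :
    dualWeight a w hd (Fin.snoc (α := fun _ => ℤ) h 0) =
      dualWeight a w ((Nat.le_succ d).trans hd) h := by
  have hs : ({j | Fin.snoc (α := fun _ => ℤ) h 0 j ≠ 0} : Finset (Fin (d + 1))) =
      ({j | h j ≠ 0} : Finset (Fin d)).map Fin.castSuccEmb := by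
    ext j
    refine Fin.lastCases ?_ (fun j => ?_) j
    · simp
    · simp
  rw [dualWeight, dualWeight, korobovWeight_half, korobovWeight_half, hs, Finset.prod_map]
  congr 2
  · simp only [unitWeights, Finset.map_eq_empty, restrictWeights, Finset.map_map]
    rfl
  · refine Finset.prod_congr rfl fun j _ => ?_
    simp

/-- The factor of the Fourier weights that does not depend on the last nonzero frequency. -/
def initWeight {s : ℕ} (a : ℕ) (w : Finset (Fin s) → ℝ≥0) {d : ℕ} (hd : d + 1 ≤ s)
    (h : Fin d → ℤ) : ℝ≥0∞ :=
  dualWeight a w hd (Fin.snoc (α := fun _ => ℤ) h 1)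

theorem dualWeight_snoc {s : ℕ} (a : ℕ) (w : Finset (Fin s) → ℝ≥0) {d : ℕ} (hd : d + 1 ≤ s)
    (h : Fin d → ℤ) {k : ℤ} (hk : k ≠ 0) :
    dualWeight a w hd (Fin.snoc (α := fun _ => ℤ) h k) =
      initWeight a w hd h * ENNReal.ofReal (decay a k) := by
  have hs : ({j | Fin.snoc (α := fun _ => ℤ) h k j ≠ 0} : Finset (Fin (d + 1))) =
      ({j | Fin.snoc (α := fun _ => ℤ) h 1 j ≠ 0} : Finset (Fin (d + 1))) := by
    ext j
    refine Fin.lastCases ?_ (fun j => ?_) j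
    · simp [hk]
    · simp
  rw [initWeight, dualWeight, dualWeight, ← ENNReal.ofReal_mul (korobovWeight_nonneg _ _ _),
    korobovWeight_half, korobovWeight_half, hs]
  simp only [Finset.prod_filter, Fin.prod_univ_castSucc]
  simp only [Fin.snoc_castSucc, Fin.snoc_last, ne_eq, one_ne_zero, not_false_eq_true, if_true]
  have : decay a 1 = 1 := by simp [decay]
  rw [this]
  ring_nf

/-- The increase of the squared worst-case error caused by a new component `c`. -/
def increment {s : ℕ} (a : ℕ) (w : Finset (Fin s) → ℝ≥0) (N : ℕ) {d : ℕ} (hd : d + 1 ≤ s)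
    (z : Fin d → ℕ) (c : ℕ) : ℝ≥0∞ :=
  ∑' k : ℤ, if k = 0 then 0 else ∑' h : Fin d → ℤ,
    if (N : ℤ) ∣ (∑ j, h j * (z j : ℤ)) + k * c then
      dualWeight a w hd (Fin.snoc (α := fun _ => ℤ) h k) else 0

theorem korobovCriterion_eq_tsum {s a N : ℕ} (ha : 2 ≤ a) (he : Even a) (hN : N ≠ 0)
    (w : Finset (Fin s) → ℝ≥0) {d : ℕ} (hd : d ≤ s) (z : Fin d → ℕ) :
    korobovCriterion ((a : ℝ) / 2) w N d hd z =
      ∑' h : Fin d → ℤ, if h ≠ 0 ∧ InDual N z h then dualWeight a w hd h else 0 :=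
  worstCaseError_korobov_sq_eq_tsum ha he hN _ z

theorem korobovCriterion_ne_top {s a N : ℕ} (ha : 2 ≤ a) (he : Even a) (hN : N ≠ 0)
    (w : Finset (Fin s) → ℝ≥0) {d : ℕ} (hd : d ≤ s) (z : Fin d → ℕ) :
    korobovCriterion ((a : ℝ) / 2) w N d hd z ≠ ∞ := by
  rw [korobovCriterion, worstCaseError_korobov_sq_eq_ofReal ha he hN]
  exact ENNReal.ofReal_ne_top

/-- Split by the last frequency: the value `0` reproduces the criterion of dimension `d`, so only
the increment depends on `c`. -/
theorem korobovCriterion_snoc {s a N : ℕ} (ha : 2 ≤ a) (he : Even a) (hN : N ≠ 0)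
    (w : Finset (Fin s) → ℝ≥0) {d : ℕ} (hd : d + 1 ≤ s) (z : Fin d → ℕ) (c : ℕ) :
    korobovCriterion ((a : ℝ) / 2) w N (d + 1) hd (Fin.snoc (α := fun _ => ℕ) z c) =
      korobovCriterion ((a : ℝ) / 2) w N d ((Nat.le_succ d).trans hd) z +
        increment a w N hd z c := by
  rw [korobovCriterion_eq_tsum ha he hN, korobovCriterion_eq_tsum ha he hN, tsum_snoc,
    ennreal_tsum_int_eq]
  congr 1
  · refine tsum_congr fun h => ?_
    simp only [dualWeight_snoc_zero, inDual_snoc, ne_eq, snoc_zero_eq_zero_iff, zero_mul,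
      add_zero]
    rfl
  · refine tsum_congr fun k => ?_
    split_ifs with hk
    · rfl
    · refine tsum_congr fun h => ?_
      simp only [inDual_snoc, ne_eq, snoc_ne_zero h hk, not_false_eq_true, true_and]

/-- The sum of the `l`-th powers of the Fourier weights of the nonzero frequencies. -/
def powerSum {s : ℕ} (a : ℕ) (w : Finset (Fin s) → ℝ≥0) (l : ℝ) {d : ℕ} (hd : d ≤ s) : ℝ≥0∞ :=
  ∑' h : Fin d → ℤ, if h ≠ 0 then dualWeight a w hd h ^ l else 0

theorem powerSum_succ {s : ℕ} {a : ℕ} (ha : a ≠ 0) (w : Finset (Fin s) → ℝ≥0) {l : ℝ} (hl : 0 < l)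
    {d : ℕ} (hd : d + 1 ≤ s) :
    powerSum a w l hd = powerSum a w l ((Nat.le_succ d).trans hd) +
      ∑' h : Fin d → ℤ, initWeight a w hd h ^ l * ∑' k : ℤ, decayPow a l k := by
  rw [powerSum, tsum_snoc, ennreal_tsum_int_eq]
  congr 1
  · refine tsum_congr fun h => ?_
    simp only [dualWeight_snoc_zero, ne_eq, snoc_zero_eq_zero_iff]
  · simp_rw [← ENNReal.tsum_mul_left]
    rw [ENNReal.tsum_comm]
    refine tsum_congr fun k => ?_
    split_ifs with hk
    · simp [hk, decayPow_zero ha hl]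
    · refine tsum_congr fun h => ?_
      rw [if_pos (snoc_ne_zero h hk), dualWeight_snoc _ _ _ _ hk,
        ENNReal.mul_rpow_of_nonneg _ _ hl.le, decayPow]

theorem increment_rpow_le {s : ℕ} (a : ℕ) (w : Finset (Fin s) → ℝ≥0) (N : ℕ)
    {l : ℝ} (hl : 0 < l) (hl1 : l ≤ 1) {d : ℕ} (hd : d + 1 ≤ s) (z : Fin d → ℕ) (c : ℕ) :
    increment a w N hd z c ^ l ≤ ∑' h : Fin d → ℤ, initWeight a w hd h ^ l *
      ∑' k : ℤ, decayPow a l k *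
        if (N : ℤ) ∣ (∑ j, h j * (z j : ℤ)) + k * c then 1 else 0 := by
  simp_rw [← ENNReal.tsum_mul_left]
  rw [ENNReal.tsum_comm]
  refine (ennreal_tsum_rpow_le _ hl hl1).trans (ENNReal.tsum_le_tsum fun k => ?_)
  split_ifs with hk
  · simp [hl]
  · refine (ennreal_tsum_rpow_le _ hl hl1).trans (ENNReal.tsum_le_tsum fun h => ?_)
    split_ifs
    · rw [dualWeight_snoc _ _ _ _ hk, ENNReal.mul_rpow_of_nonneg _ _ hl.le, decayPow, mul_one]
    · simp [hl]

/-- Interchanging the sums, for fixed initial frequencies `h` the sum over `c` counts solutions of a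
congruence with `m = ∑_j h_j z_j`; the resulting bound does not depend on `z`. -/
theorem sum_increment_rpow_le {s a N : ℕ} (hN : N.Prime) (w : Finset (Fin s) → ℝ≥0)
    {l : ℝ} (hl : 0 < l) (hl1 : l ≤ 1) (hal : 1 < a * l) {d : ℕ} (hd : d + 1 ≤ s)
    (z : Fin d → ℕ) :
    ∑ c ∈ Finset.Icc 1 (N - 1), increment a w N hd z c ^ l ≤
      ∑' h : Fin d → ℤ, initWeight a w hd h ^ l * ∑' k : ℤ, decayPow a l k := by
  refine (Finset.sum_le_sum fun c _ => increment_rpow_le a w N hl hl1 hd z c).trans ?_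
  rw [← Summable.tsum_finsetSum fun _ _ => ENNReal.summable]
  refine ENNReal.tsum_le_tsum fun h => ?_
  rw [← Finset.mul_sum]
  refine mul_le_mul_right ?_ _
  rw [← Summable.tsum_finsetSum fun _ _ => ENNReal.summable]
  refine le_trans (le_of_eq (tsum_congr fun k => ?_))
    (tsum_decayPow_mul_card_le hN hl hal (∑ j, h j * (z j : ℤ)))
  rw [← Finset.mul_sum, Finset.sum_boole]

/-! ### The error bound for the component-by-component algorithm -/

theorem restrict_succ_eq_snoc {s d : ℕ} (hd : d < s) (z : Fin s → ℕ) :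
    (fun j : Fin (d + 1) => z (Fin.castLE hd j)) =
      Fin.snoc (α := fun _ => ℕ) (fun j : Fin d => z (Fin.castLE hd.le j)) (z ⟨d, hd⟩) := by
  ext j
  refine Fin.lastCases ?_ (fun j => ?_) j
  · simp only [Fin.snoc_last]
    rfl
  · simp only [Fin.snoc_castSucc]
    rfl

theorem IsCBCOutput.criterion_rpow_le {s a N : ℕ} (ha : 2 ≤ a) (he : Even a) (hN : N.Prime)
    (w : Finset (Fin s) → ℝ≥0) {z : Fin s → ℕ}
    (hz : IsCBCOutput N (korobovCriterion ((a : ℝ) / 2) w N) z) {l : ℝ} (hl : 0 < l) (hl1 : l ≤ 1)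
    (hal : 1 < a * l) : ∀ {d : ℕ} (hd : d ≤ s),
      ((N - 1 : ℕ) : ℝ≥0∞) *
        korobovCriterion ((a : ℝ) / 2) w N d hd (fun j => z (Fin.castLE hd j)) ^ l ≤
        powerSum a w l hd
  | 0, hd => by
    rw [korobovCriterion_eq_tsum ha he hN.ne_zero]
    rw [ENNReal.tsum_eq_zero.mpr fun h => if_neg fun hh => hh.1 (Subsingleton.elim _ _),
      ENNReal.zero_rpow_of_pos hl, mul_zero]
    exact zero_le
  | d + 1, hd => by
    have ih := criterion_rpow_le ha he hN w hz hl hl1 hal ((Nat.le_succ d).trans hd)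
    obtain ⟨-, hmin⟩ := hz d hd
    rw [restrict_succ_eq_snoc hd, korobovCriterion_snoc ha he hN.ne_zero, powerSum_succ (by omega) w hl]
    refine (mul_le_mul_right (ENNReal.rpow_add_le_add_rpow _ _ hl.le hl1) _).trans ?_
    rw [mul_add]
    refine add_le_add ih ((le_trans ?_ (sum_increment_rpow_le hN w hl hl1 hal hd
      fun j => z (Fin.castLE ((Nat.le_succ d).trans hd) j))))
    have hc : ((N - 1 : ℕ) : ℝ≥0∞) = (Finset.Icc 1 (N - 1)).card := by simp
    rw [hc, ← nsmul_eq_mul, ← Finset.sum_const]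
    -- The chosen component has the least increment: minimality compares the full criteria, and
    -- their common finite part cancels.
    refine Finset.sum_le_sum fun c hcm => ENNReal.rpow_le_rpow ?_ hl.le
    have := hmin c hcm
    rw [korobovCriterion_snoc ha he hN.ne_zero, korobovCriterion_snoc ha he hN.ne_zero] at this
    exact (ENNReal.add_le_add_iff_left
      (korobovCriterion_ne_top ha he hN.ne_zero w _ _)).mp this

theorem restrictWeights_self {s : ℕ} (w : Finset (Fin s) → ℝ≥0) :
    restrictWeights le_rfl w = w := by
  ext u
  rw [restrictWeights]
  congr 2
  ext j
  simp

/-- Nonzero frequencies are grouped by their nonempty support, and each group factors over the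
coordinates. -/
theorem powerSum_eq {s a : ℕ} (ha : a ≠ 0) (w : Finset (Fin s) → ℝ≥0) {l : ℝ} (hl : 0 < l) :
    powerSum a w l le_rfl = ∑ u ∈ (Finset.univ : Finset (Finset (Fin s))).erase ∅,
      (w u : ℝ≥0∞) ^ l * (∑' k : ℤ, decayPow a l k) ^ u.card := by
  have h1 : ∀ u : Finset (Fin s), (∑' k : ℤ, decayPow a l k) ^ u.card =
      ∑' h : Fin s → ℤ, ∏ j, if j ∈ u then decayPow a l (h j) else if h j = 0 then 1 else 0 := by
    intro u
    rw [ennreal_tsum_pi_prod fun j k => if j ∈ u then decayPow a l k else if k = 0 then 1 else 0,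
      ← Finset.prod_const, ← Finset.univ_inter u, ← Finset.prod_ite_mem, Finset.univ_inter]
    refine Finset.prod_congr rfl fun j _ => ?_
    split_ifs with hj
    · rfl
    · rw [tsum_ite_eq]
  simp_rw [h1, ← ENNReal.tsum_mul_left]
  rw [← Summable.tsum_finsetSum fun _ _ => ENNReal.summable, powerSum]
  refine tsum_congr fun h => ?_
  have h2 : ∀ u : Finset (Fin s), _ := fun u => prod_ite_support u h (fun j => decayPow a l (h j))
    fun j hj => by rw [hj, decayPow_zero ha hl]
  simp only [h2, mul_ite, mul_zero, Finset.sum_ite_eq', Finset.mem_erase, Finset.mem_univ,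
    and_true]
  have h3 : ({j | h j ≠ 0} : Finset (Fin s)) ≠ ∅ ↔ h ≠ 0 := by
    rw [← Finset.nonempty_iff_ne_empty, Function.ne_iff]
    simp [Finset.Nonempty]
  simp only [h3]
  split_ifs with h0
  · rw [dualWeight, restrictWeights_self, korobovWeight_half, unitWeights, if_neg (h3.mpr h0),
      ENNReal.ofReal_mul NNReal.zero_le_coe, ENNReal.mul_rpow_of_nonneg _ _ hl.le,
      ENNReal.ofReal_coe_nnreal, ENNReal.ofReal_prod_of_nonneg fun _ _ => decay_nonneg _ _,
      ← ENNReal.prod_rpow_of_nonneg hl.le]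
    rfl
  · rfl

theorem exists_isCBCOutput {s N : ℕ} (hN : 2 ≤ N)
    (E : ∀ d : ℕ, d ≤ s → (Fin d → ℕ) → ℝ≥0∞) : ∃ z : Fin s → ℕ, IsCBCOutput N E z := by
  have key : ∀ m : ℕ, ∃ z : Fin s → ℕ, ∀ (d : ℕ) (hd : d < s), d < m →
      z ⟨d, hd⟩ ∈ Finset.Icc 1 (N - 1) ∧ ∀ c ∈ Finset.Icc 1 (N - 1),
        E (d + 1) hd (Fin.snoc (fun j : Fin d => z (Fin.castLE hd.le j)) (z ⟨d, hd⟩)) ≤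
          E (d + 1) hd (Fin.snoc (fun j : Fin d => z (Fin.castLE hd.le j)) c) := by
    intro m
    induction m with
    | zero => exact ⟨0, fun d _ hd => absurd hd (Nat.not_lt_zero d)⟩
    | succ m ih =>
      obtain ⟨z, hz⟩ := ih
      by_cases hm : m < s
      · obtain ⟨c, hc, hmin⟩ := Finset.exists_min_image (Finset.Icc 1 (N - 1))
          (fun c => E (m + 1) hm (Fin.snoc (fun j : Fin m => z (Fin.castLE hm.le j)) c))
          ⟨1, by simp; omega⟩
        -- Changing the component at position `m` leaves all shorter prefixes intact, so the earlier
        -- minimality statements persist.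
        have hr : ∀ (d : ℕ) (hd : d ≤ m), (fun j : Fin d => Function.update z ⟨m, hm⟩ c
            (Fin.castLE (hd.trans hm.le) j)) = fun j => z (Fin.castLE (hd.trans hm.le) j) := by
          intro d hd
          ext j
          rw [Function.update_of_ne]
          intro h
          have h1 := congrArg Fin.val h
          simp only [Fin.val_castLE] at h1
          omega
        refine ⟨Function.update z ⟨m, hm⟩ c, fun d hd hdm => ?_⟩
        rw [hr d (by omega)]
        rcases Nat.lt_succ_iff_lt_or_eq.mp hdm with h | rfl
        · have hne : (⟨d, hd⟩ : Fin s) ≠ ⟨m, hm⟩ := by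
            simp only [ne_eq, Fin.mk.injEq]
            omega
          rw [Function.update_of_ne hne]
          exact hz d hd h
        · rw [Function.update_self]
          exact ⟨hc, hmin⟩
      · exact ⟨z, fun d hd _ => hz d hd (by omega)⟩
  obtain ⟨z, hz⟩ := key s
  exact ⟨z, fun d hd => hz d hd hd⟩

/-! ### The explicit error bound -/

theorem hasSum_zeta_re {x : ℝ} (hx : 1 < x) :
    HasSum (fun n : ℕ => ((n : ℝ) + 1) ^ (-x)) (riemannZeta (x : ℂ)).re := by
  have hs : Summable fun n : ℕ => ((n : ℝ) + 1) ^ (-x) := by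
    have := (summable_nat_add_iff 1).mpr (Real.summable_nat_rpow.mpr (by linarith : -x < -1))
    simpa using this
  have h1 : riemannZeta (x : ℂ) = ((∑' n : ℕ, ((n : ℝ) + 1) ^ (-x) : ℝ) : ℂ) := by
    rw [zeta_eq_tsum_one_div_nat_add_one_cpow (by simpa using hx), Complex.ofReal_tsum]
    refine tsum_congr fun n => ?_
    rw [Complex.ofReal_cpow (by positivity)]
    push_cast
    rw [Complex.cpow_neg, one_div]
  rw [h1, Complex.ofReal_re]
  exact hs.hasSum

/-- Positive and negative frequencies give `ζ(al)` each; the term at `0` vanishes by the convention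
for real powers of `0`. -/
theorem tsum_decayPow {a : ℕ} {l : ℝ} (hl : 0 < l) (hal : 1 < a * l) :
    ∑' k : ℤ, decayPow a l k =
      ENNReal.ofReal (2 * (riemannZeta (((a : ℝ) * l : ℝ) : ℂ)).re) := by
  have h0 : ∀ k : ℤ, decayPow a l k = ENNReal.ofReal (|(k : ℝ)| ^ (-((a : ℝ) * l))) := by
    intro k
    rw [decayPow, ENNReal.ofReal_rpow_of_nonneg (decay_nonneg a k) hl.le, decay,
      ← Real.rpow_mul (abs_nonneg _), neg_mul]
  have hne : -((a : ℝ) * l) ≠ 0 := by linarith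
  have hz := hasSum_zeta_re hal
  have hs : HasSum (fun k : ℤ => |(k : ℝ)| ^ (-((a : ℝ) * l)))
      ((riemannZeta (((a : ℝ) * l : ℝ) : ℂ)).re + |((0 : ℤ) : ℝ)| ^ (-((a : ℝ) * l)) +
        (riemannZeta (((a : ℝ) * l : ℝ) : ℂ)).re) := by
    refine HasSum.of_add_one_of_neg_add_one (f := fun k : ℤ => |(k : ℝ)| ^ (-((a : ℝ) * l))) ?_ ?_
    · convert! hz using 2 with n
      push_cast
      rw [abs_of_nonneg (by positivity)]
    · convert! hz using 2 with n
      push_cast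
      rw [abs_neg, abs_of_nonneg (by positivity)]
  rw [Int.cast_zero, abs_zero, Real.zero_rpow hne, add_zero, ← two_mul] at hs
  rw [← hs.tsum_eq, ENNReal.ofReal_tsum_of_nonneg (fun k => by positivity) hs.summable]
  exact tsum_congr h0

theorem modifiedWeights_rpow {s : ℕ} (a : ℕ) (γ : Finset (Fin s) → ℝ≥0) (u : Finset (Fin s))
    (l : ℝ) : (modifiedWeights a γ u : ℝ) ^ l = (γ u : ℝ) ^ (l / 2) *
      ((3 : ℝ) ^ (l / 2) / ((2 : ℝ) ^ ((2 * (a : ℝ) + 1) * l / 2) * Real.pi ^ ((a : ℝ) * l)))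
        ^ u.card := by
  have hpi := Real.pi_pos
  rw [modifiedWeights, Real.coe_sqrt, Real.sqrt_eq_rpow, ← Real.rpow_mul NNReal.zero_le_coe,
    show 1 / 2 * l = l / 2 by ring]
  push_cast
  rw [NNReal.coe_real_pi, Real.mul_rpow NNReal.zero_le_coe (by positivity)]
  congr 1
  rw [← Real.rpow_pow_comm (by positivity), Real.div_rpow (by positivity) (by positivity),
    Real.mul_rpow (by positivity) (by positivity), ← Real.rpow_natCast 2, ← Real.rpow_natCast Real.pi,
    ← Real.rpow_mul (by positivity), ← Real.rpow_mul hpi.le]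
  push_cast
  congr 4 <;> ring

theorem powerSum_modifiedWeights {s a : ℕ} (ha : a ≠ 0) (γ : Finset (Fin s) → ℝ≥0) {l : ℝ}
    (hl : 0 < l) (hal : 1 < a * l) : powerSum a (modifiedWeights a γ) l le_rfl =
      ENNReal.ofReal (∑ u ∈ (Finset.univ : Finset (Finset (Fin s))).erase ∅,
        (γ u : ℝ) ^ (l / 2) * ((3 : ℝ) ^ (l / 2) * (riemannZeta (((a : ℝ) * l : ℝ) : ℂ)).re /
          ((2 : ℝ) ^ ((2 * (a : ℝ) + 1) * l / 2 - 1) * Real.pi ^ ((a : ℝ) * l))) ^ u.card) := by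
  have hz : 0 ≤ (riemannZeta (((a : ℝ) * l : ℝ) : ℂ)).re :=
    (hasSum_zeta_re hal).nonneg fun n => by positivity
  have hpi := Real.pi_pos
  rw [powerSum_eq ha _ hl, tsum_decayPow hl hal,
    ENNReal.ofReal_sum_of_nonneg fun u _ => by positivity]
  refine Finset.sum_congr rfl fun u _ => ?_
  rw [← ENNReal.ofReal_coe_nnreal, ENNReal.ofReal_rpow_of_nonneg NNReal.zero_le_coe hl.le,
    ← ENNReal.ofReal_pow (by positivity), ← ENNReal.ofReal_mul (by positivity),
    -- The `2` of `2ζ(al)` is absorbed as the `- 1` in the exponent of `2` in the denominator.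
    modifiedWeights_rpow, mul_assoc, ← mul_pow, Real.rpow_sub two_pos, Real.rpow_one]
  congr 3
  field_simp

theorem korobovCriterion_self {s a N : ℕ} (ha : 2 ≤ a) (he : Even a) (hN : N ≠ 0)
    (w : Finset (Fin s) → ℝ≥0) (z : Fin s → ℕ) :
    korobovCriterion ((a : ℝ) / 2) w N s le_rfl z =
      worstCaseError (KorobovSpace ((a : ℝ) / 2) w) (latticePoints N z) ^ 2 := by
  rw [korobovCriterion_eq_tsum ha he hN, worstCaseError_korobov_sq_eq_tsum ha he hN]
  simp only [dualWeight, restrictWeights_self]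

theorem IsCBCOutput.worstCaseError_sq_le {s a N : ℕ} (ha : 2 ≤ a) (he : Even a) (hN : N.Prime)
    (γ : Finset (Fin s) → ℝ≥0) {z : Fin s → ℕ}
    (hz : IsCBCOutput N (korobovCriterion ((a : ℝ) / 2) (modifiedWeights a γ) N) z) {l : ℝ}
    (hal : 1 / (a : ℝ) < l) (hl1 : l ≤ 1) :
    worstCaseError (KorobovSpace ((a : ℝ) / 2) (modifiedWeights a γ)) (latticePoints N z) ^ 2 ≤
      ENNReal.ofReal (1 / ((N : ℝ) - 1) ^ (1 / l) *
        (∑ u ∈ (Finset.univ : Finset (Finset (Fin s))).erase ∅,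
          (γ u : ℝ) ^ (l / 2) * ((3 : ℝ) ^ (l / 2) * (riemannZeta (((a : ℝ) * l : ℝ) : ℂ)).re /
            ((2 : ℝ) ^ ((2 * (a : ℝ) + 1) * l / 2 - 1) * Real.pi ^ ((a : ℝ) * l))) ^ u.card)
              ^ (1 / l)) := by
  have ha0 : (0 : ℝ) < a := by exact_mod_cast (by omega : 0 < a)
  have hl : 0 < l := lt_trans (by positivity) hal
  have hal' : 1 < a * l := by rwa [div_lt_iff₀' ha0] at hal
  have hN1 : (0 : ℝ) < (N : ℝ) - 1 := by
    have : (2 : ℝ) ≤ N := by exact_mod_cast hN.two_le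
    linarith
  have hz0 : 0 ≤ (riemannZeta (((a : ℝ) * l : ℝ) : ℂ)).re :=
    (hasSum_zeta_re hal').nonneg fun n => by positivity
  have hpi := Real.pi_pos
  have h := hz.criterion_rpow_le ha he hN _ hl hl1 hal' le_rfl
  rw [powerSum_modifiedWeights (by omega) γ hl hal', korobovCriterion_self ha he hN.ne_zero] at h
  set X := ∑ u ∈ (Finset.univ : Finset (Finset (Fin s))).erase ∅,
    (γ u : ℝ) ^ (l / 2) * ((3 : ℝ) ^ (l / 2) * (riemannZeta (((a : ℝ) * l : ℝ) : ℂ)).re /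
      ((2 : ℝ) ^ ((2 * (a : ℝ) + 1) * l / 2 - 1) * Real.pi ^ ((a : ℝ) * l))) ^ u.card with hX
  have hX0 : 0 ≤ X := Finset.sum_nonneg fun u _ => by positivity
  have hNc : ((N - 1 : ℕ) : ℝ≥0∞) = ENNReal.ofReal ((N : ℝ) - 1) := by
    rw [← ENNReal.ofReal_natCast, Nat.cast_sub hN.one_le, Nat.cast_one]
  have e : 1 / ((N : ℝ) - 1) ^ (1 / l) * X ^ (1 / l) = (X / ((N : ℝ) - 1)) ^ l⁻¹ := by
    rw [Real.div_rpow hX0 hN1.le, one_div l]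
    ring
  rw [e, ← ENNReal.ofReal_rpow_of_nonneg (by positivity) (by positivity),
    ENNReal.le_rpow_inv_iff hl, ENNReal.ofReal_div_of_pos hN1,
    ENNReal.le_div_iff_mul_le (Or.inl (by simpa using hN1)) (Or.inl ENNReal.ofReal_ne_top),
    mul_comm, ← hNc]
  exact h

end LatticeQMC

end

/-! ### The error bounds and the convergence rate. -/

theorem corollary2 (s α : ℕ) [NeZero s] [NeZero α] (hα : Even α)
    (γ : Finset (Fin s) → ℝ≥0) :
    (∀ N : ℕ, N.Prime →
      (∃ z : Fin s → ℕ, LatticeQMC.IsCBCOutput N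
        (LatticeQMC.korobovCriterion ((α : ℝ) / 2) (LatticeQMC.modifiedWeights α γ) N) z) ∧
      ∀ z : Fin s → ℕ, LatticeQMC.IsCBCOutput N
          (LatticeQMC.korobovCriterion ((α : ℝ) / 2) (LatticeQMC.modifiedWeights α γ) N) z →
        LatticeQMC.worstCaseError (LatticeQMC.SobOddSpace α γ)
            (LatticeQMC.symmetrize (LatticeQMC.latticePoints N z)) ≤
          LatticeQMC.worstCaseError
            (LatticeQMC.KorobovSpace ((α : ℝ) / 2) (LatticeQMC.modifiedWeights α γ))
            (LatticeQMC.latticePoints N z) ^ 2 ∧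
        ∀ l : ℝ, 1 / (α : ℝ) < l → l ≤ 1 →
          LatticeQMC.worstCaseError
              (LatticeQMC.KorobovSpace ((α : ℝ) / 2) (LatticeQMC.modifiedWeights α γ))
              (LatticeQMC.latticePoints N z) ^ 2 ≤
            ENNReal.ofReal (1 / ((N : ℝ) - 1) ^ (1 / l) *
              (∑ u ∈ (Finset.univ : Finset (Finset (Fin s))).erase ∅,
                (γ u : ℝ) ^ (l / 2) *
                  ((3 : ℝ) ^ (l / 2) * (riemannZeta (((α : ℝ) * l : ℝ) : ℂ)).re /
                    ((2 : ℝ) ^ ((2 * (α : ℝ) + 1) * l / 2 - 1) *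
                      Real.pi ^ ((α : ℝ) * l))) ^ u.card) ^ (1 / l))) ∧
    (∀ ε : ℝ, 0 < ε → ∃ C : ℝ, ∀ N : ℕ, N.Prime → ∀ z : Fin s → ℕ,
      LatticeQMC.IsCBCOutput N
          (LatticeQMC.korobovCriterion ((α : ℝ) / 2) (LatticeQMC.modifiedWeights α γ) N) z →
        LatticeQMC.worstCaseError (LatticeQMC.SobOddSpace α γ)
            (LatticeQMC.symmetrize (LatticeQMC.latticePoints N z)) ≤
          ENNReal.ofReal (C * (N : ℝ) ^ (-(α : ℝ) + ε))) := by
  have hα2 : 2 ≤ α := by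
    have := NeZero.ne α
    obtain ⟨m, hm⟩ := hα
    omega
  refine ⟨fun N hN => ⟨LatticeQMC.exists_isCBCOutput hN.two_le _, fun z hz =>
    ⟨LatticeQMC.worstCaseError_sobOdd_le hα2 hα hN.ne_zero γ z, fun l hl hl1 =>
      hz.worstCaseError_sq_le hα2 hα hN γ hl hl1⟩⟩, fun ε hε => ?_⟩
  have hα2' : (2 : ℝ) ≤ α := by exact_mod_cast hα2
  -- The exponent is `λ = 1 / M`. The maximum with `1` keeps `λ ≤ 1` when `ε` is large, `M < α`
  -- gives `λ > 1/α`, and `-M ≤ -α + ε` gives the rate.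
  set M : ℝ := max 1 (α - ε) with hM
  have hM1 : 1 ≤ M := le_max_left _ _
  have hM0 : 0 < M := by linarith
  have hMα : M < α := max_lt (by linarith) (by linarith)
  have hl : 1 / (α : ℝ) < 1 / M := one_div_lt_one_div_of_lt hM0 hMα
  have hl1 : 1 / M ≤ 1 := (div_le_one hM0).mpr hM1
  -- The factor `2 ^ M` comes from `N - 1 ≥ N / 2`; the absolute value makes the constant
  -- nonnegative without a sign argument for the sum.
  refine ⟨2 ^ M * |(∑ u ∈ (Finset.univ : Finset (Finset (Fin s))).erase ∅,
    (γ u : ℝ) ^ (1 / M / 2) *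
      ((3 : ℝ) ^ (1 / M / 2) * (riemannZeta (((α : ℝ) * (1 / M) : ℝ) : ℂ)).re /
        ((2 : ℝ) ^ ((2 * (α : ℝ) + 1) * (1 / M) / 2 - 1) *
          Real.pi ^ ((α : ℝ) * (1 / M)))) ^ u.card) ^ (1 / (1 / M))|, fun N hN z hz => ?_⟩
  refine (LatticeQMC.worstCaseError_sobOdd_le hα2 hα hN.ne_zero γ z).trans
    ((hz.worstCaseError_sq_le hα2 hα hN γ hl hl1).trans (ENNReal.ofReal_le_ofReal ?_))
  have hN2 : (2 : ℝ) ≤ N := by exact_mod_cast hN.two_le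
  have hN0 : (0 : ℝ) < N := by linarith
  rw [mul_right_comm]
  have hfac : 1 / ((N : ℝ) - 1) ^ (1 / (1 / M)) ≤ 2 ^ M * (N : ℝ) ^ (-(α : ℝ) + ε) := by
    rw [one_div_one_div]
    calc 1 / ((N : ℝ) - 1) ^ M ≤ 1 / ((N : ℝ) / 2) ^ M :=
          one_div_le_one_div_of_le (by positivity)
            (Real.rpow_le_rpow (by positivity) (by linarith) hM0.le)
      _ = 2 ^ M * (N : ℝ) ^ (-M) := by
          rw [Real.div_rpow hN0.le two_pos.le, Real.rpow_neg hN0.le, one_div_div, div_eq_mul_inv]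
      _ ≤ 2 ^ M * (N : ℝ) ^ (-(α : ℝ) + ε) := by
          refine mul_le_mul_of_nonneg_left
            (Real.rpow_le_rpow_of_exponent_le (by linarith) ?_) (by positivity)
          have := le_max_right 1 ((α : ℝ) - ε)
          linarith
  have hpos : 0 ≤ 1 / ((N : ℝ) - 1) ^ (1 / (1 / M)) :=
    one_div_nonneg.mpr (Real.rpow_nonneg (by linarith) _)
  exact (mul_le_mul_of_nonneg_left (le_abs_self _) hpos).trans
    (mul_le_mul_of_nonneg_right hfac (abs_nonneg _))
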